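/- Let $0<\mathit{Pr}<\infty$, $R>0$, $L_x,L_y>0$ and $0\le\eta\le\infty$. Consider the nondimensional Boussinesq equations $$\mathit{Pr}^{-1}\left(\partial_t\mathbf u+\mathbf u\cdot\nabla\mathbf u\right)+\nabla p=\nabla^2\mathbf u+R\,T\,\mathbf e_z,\qquad \nabla\cdot\mathbf u=0,\qquad \partial_tT+\mathbf u\cdot\nabla T=\nabla^2T$$ in the layer $0<z<1$, with all of $\mathbf u,p,T$ periodic in $x$ and $y$ with periods $L_x$ and $L_y$, with no-slip walls $\mathbf u|_{z=0,1}=\mathbf 0$, and with thermal boundary conditions of Biot number $\eta$: if $\eta<\infty$, $$T-\eta\,T_z=1+\eta\ \text{ on } z=0,\qquad T+\eta\,T_z=-\eta\ \text{ on } z=1,$$ and if $\eta=\infty$, $T_z=-1$ on $z=0$ and on $z=1$. Let $0<t_{\max}\le\infty$. A classical solution on $(0,t_{\max})$ is a triple $(\mathbf u,p,T)$ satisfying all of the above for $0<t<t_{\max}$, with $\mathbf u(\cdot,t)$ and $T(\cdot,t)$ of class $C^2$ and $p(\cdot,t)$ of class $C^1$ on $\mathbb R^2\times[0,1]$ for each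 such $t$, with $\mathbf u,T,\partial_t\mathbf u,\partial_tT$ jointly continuous on $(0,t_{\max})\times\mathbb R^2\times[0,1]$, and with square-integrable initial values attained in the sense that $\mathbf u(\cdot,t)\to\mathbf u(\cdot,0)$ and $T(\cdot,t)\to T(\cdot,0)$ in $\mathrm L^2$ as $t\to0^+$. Here $\|\cdot\|$ denotes the $\mathrm L^2$ norm over $[0,L_x]\times[0,L_y]\times[0,1]$. Then the velocity and temperature are bounded in $\mathrm L^2$ uniformly in time: there is a constant $C$, depending only on $\mathit{Pr},R,L_x,L_y,\eta$, such that for every $t_{\max}$, every classical solution on $(0,t_{\max})$ and every $0\le t<t_{\max}$, $$\|\mathbf u(\cdot,t)\|+\|T(\cdot,t)\|\le C\left(1+\|\mathbf u(\cdot,0)\|+\|T(\cdot,0)\|\right).$$ -/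

import Mathlib

open MeasureTheory Filter Topology
open scoped ENNReal NNReal

namespace RayleighBenard

/-- Points `(x, y, z)` of space. -/
abbrev Pt : Type := Fin 3 → ℝ

/-- Velocity vectors `(u, v, w)`, with the Euclidean norm. -/
abbrev Vel : Type := EuclideanSpace ℝ (Fin 3)

/-- The closed fluid layer `0 ≤ z ≤ 1`, unbounded in the horizontal directions. -/
def slab : Set Pt := {x | 0 ≤ x 2 ∧ x 2 ≤ 1}

/-- One period cell `[0, Lx] × [0, Ly] × [0, 1]` of the fluid layer. -/
def cell (Lx Ly : ℝ) : Set Pt := Set.Icc 0 ![Lx, Ly, 1]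

/-- The `L²` norm over one period cell, with values in `[0, ∞]`. -/
noncomputable def normL2 {F : Type} [NormedAddCommGroup F] (Lx Ly : ℝ) (f : Pt → F) : ℝ≥0∞ :=
  eLpNorm f 2 (volume.restrict (cell Lx Ly))

/-- The partial derivative in the `i`-th space direction, taken within the closed layer
(so it is the ordinary one in the interior and includes the one-sided `z`-derivative at the
walls `z = 0` and `z = 1`). -/
noncomputable def pd (i : Fin 3) (f : Pt → ℝ) (x : Pt) : ℝ :=
  fderivWithin ℝ f slab x (Pi.single i 1)

/-- The Laplacian of a scalar field. -/
noncomputable def lap (f : Pt → ℝ) (x : Pt) : ℝ := ∑ j, pd j (pd j f) x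

/-- Periodicity in `x` and `y` with periods `Lx` and `Ly` of a field on the layer. -/
def HorizPeriodic {F : Type} (Lx Ly : ℝ) (f : Pt → F) : Prop :=
  ∀ x ∈ slab, f (x + Pi.single 0 Lx) = f x ∧ f (x + Pi.single 1 Ly) = f x

/-- The thermal boundary conditions of Biot number `η ∈ [0, ∞]`:
`T - η T_z = 1 + η` at `z = 0` and `T + η T_z = -η` at `z = 1` if `η < ∞`
(fixed temperatures for `η = 0`), and `T_z = -1` at `z = 0, 1` if `η = ∞` (fixed flux). -/
def ThermalBC (η : ℝ≥0∞) (T : Pt → ℝ) : Prop :=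
  (η ≠ ⊤ →
    (∀ x : Pt, x 2 = 0 → T x - η.toReal * pd 2 T x = 1 + η.toReal) ∧
    (∀ x : Pt, x 2 = 1 → T x + η.toReal * pd 2 T x = -η.toReal)) ∧
  (η = ⊤ → ∀ x : Pt, x 2 = 0 ∨ x 2 = 1 → pd 2 T x = -1)

/-- The open time interval `(0, tmax)`, where `tmax = ⊤` is allowed. -/
def times (tmax : EReal) : Set ℝ := {t | 0 < t ∧ (t : EReal) < tmax}

/-- `(u, p, T)` is a classical solution on `(0, tmax)` of the nondimensional Boussinesq equations
with Prandtl number `Pr`, control parameter `R`, horizontal periods `Lx`, `Ly`, no-slip walls at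
`z = 0, 1` and thermal boundary conditions of Biot number `η`, taking its square-integrable
initial values `u 0`, `T 0` in the sense of `L²`. -/
structure IsSolution (Pr R Lx Ly : ℝ) (η : ℝ≥0∞) (tmax : EReal)
    (u : ℝ → Pt → Vel) (p : ℝ → Pt → ℝ) (T : ℝ → Pt → ℝ) : Prop where
  -- regularity at positive times, up to the walls
  u_contDiff : ∀ t ∈ times tmax, ContDiffOn ℝ 2 (u t) slab
  T_contDiff : ∀ t ∈ times tmax, ContDiffOn ℝ 2 (T t) slab
  p_contDiff : ∀ t ∈ times tmax, ContDiffOn ℝ 1 (p t) slab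
  u_differentiable : ∀ t ∈ times tmax, ∀ x ∈ slab, DifferentiableAt ℝ (fun s => u s x) t
  T_differentiable : ∀ t ∈ times tmax, ∀ x ∈ slab, DifferentiableAt ℝ (fun s => T s x) t
  u_continuous : ContinuousOn (fun q : ℝ × Pt => u q.1 q.2) (times tmax ×ˢ slab)
  T_continuous : ContinuousOn (fun q : ℝ × Pt => T q.1 q.2) (times tmax ×ˢ slab)
  ut_continuous :
    ContinuousOn (fun q : ℝ × Pt => deriv (fun s => u s q.2) q.1) (times tmax ×ˢ slab)
  Tt_continuous :
    ContinuousOn (fun q : ℝ × Pt => deriv (fun s => T s q.2) q.1) (times tmax ×ˢ slab)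
  -- horizontal periodicity
  u_periodic : ∀ t ∈ times tmax, HorizPeriodic Lx Ly (u t)
  p_periodic : ∀ t ∈ times tmax, HorizPeriodic Lx Ly (p t)
  T_periodic : ∀ t ∈ times tmax, HorizPeriodic Lx Ly (T t)
  -- the equations in the interior of the layer
  momentum : ∀ t ∈ times tmax, ∀ x : Pt, 0 < x 2 → x 2 < 1 → ∀ i : Fin 3,
    Pr⁻¹ * (deriv (fun s => u s x i) t + ∑ j, u t x j * pd j (fun y => u t y i) x) + pd i (p t) x
      = lap (fun y => u t y i) x + (if i = 2 then R * T t x else 0)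
  incompressible : ∀ t ∈ times tmax, ∀ x : Pt, 0 < x 2 → x 2 < 1 →
    ∑ j, pd j (fun y => u t y j) x = 0
  heat : ∀ t ∈ times tmax, ∀ x : Pt, 0 < x 2 → x 2 < 1 →
    deriv (fun s => T s x) t + ∑ j, u t x j * pd j (T t) x = lap (T t) x
  -- the boundary conditions at the walls
  no_slip : ∀ t ∈ times tmax, ∀ x : Pt, x 2 = 0 ∨ x 2 = 1 → u t x = 0
  thermal : ∀ t ∈ times tmax, ThermalBC η (T t)
  -- the initial values
  u_zero_memLp : MemLp (u 0) 2 (volume.restrict (cell Lx Ly))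
  T_zero_memLp : MemLp (T 0) 2 (volume.restrict (cell Lx Ly))
  u_initial : Tendsto (fun t => normL2 Lx Ly (fun x => u t x - u 0 x)) (𝓝[>] 0) (𝓝 0)
  T_initial : Tendsto (fun t => normL2 Lx Ly (fun x => T t x - T 0 x)) (𝓝[>] 0) (𝓝 0)

end RayleighBenard

namespace RayleighBenard

/-! ### Calculus on the closed layer -/

theorem convex_slab : Convex ℝ slab :=
  (convex_Icc (0 : ℝ) 1).linear_preimage (LinearMap.proj (R := ℝ) (φ := fun _ : Fin 3 => ℝ) 2)

theorem slab_mem_nhds {x : Pt} (h0 : 0 < x 2) (h1 : x 2 < 1) : slab ∈ 𝓝 x :=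
  (continuous_apply 2).continuousAt.preimage_mem_nhds (Icc_mem_nhds h0 h1)

theorem uniqueDiffOn_slab : UniqueDiffOn ℝ slab := by
  refine uniqueDiffOn_convex convex_slab ⟨fun _ => 1 / 2, ?_⟩
  exact mem_interior_iff_mem_nhds.2 (slab_mem_nhds (by norm_num) (by norm_num))

theorem cell_subset_slab (Lx Ly : ℝ) : cell Lx Ly ⊆ slab := fun x hx => by
  have h0 := hx.1 2
  have h1 := hx.2 2
  exact ⟨by simpa using h0, by simpa using h1⟩

theorem isCompact_cell (Lx Ly : ℝ) : IsCompact (cell Lx Ly) := isCompact_Icc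

theorem measurableSet_cell (Lx Ly : ℝ) : MeasurableSet (cell Lx Ly) := measurableSet_Icc

theorem isFiniteMeasure_cell (Lx Ly : ℝ) : IsFiniteMeasure (volume.restrict (cell Lx Ly)) :=
  ⟨by simpa using (isCompact_cell Lx Ly).measure_lt_top⟩

theorem integrableOn_cell {f : Pt → ℝ} (hf : ContinuousOn f slab) (Lx Ly : ℝ) :
    IntegrableOn f (cell Lx Ly) :=
  (hf.mono (cell_subset_slab Lx Ly)).integrableOn_compact (isCompact_cell Lx Ly)

theorem interior_ae_eq_cell (Lx Ly : ℝ) :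
    (Set.pi Set.univ fun i : Fin 3 => Set.Ioo (0 : ℝ) ((![Lx, Ly, 1] : Pt) i))
      =ᵐ[volume] cell Lx Ly :=
  Measure.univ_pi_Ioo_ae_eq_Icc (f := (0 : Pt))

theorem setIntegral_cell_congr {f g : Pt → ℝ} (Lx Ly : ℝ)
    (h : ∀ x, 0 < x 2 → x 2 < 1 → f x = g x) :
    ∫ x in cell Lx Ly, f x = ∫ x in cell Lx Ly, g x := by
  rw [← setIntegral_congr_set (interior_ae_eq_cell Lx Ly),
    ← setIntegral_congr_set (interior_ae_eq_cell Lx Ly)]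
  refine setIntegral_congr_fun (MeasurableSet.univ_pi fun i => measurableSet_Ioo) fun x hx => ?_
  have := hx 2 trivial
  simp only [Set.mem_Ioo] at this
  exact h x this.1 (by simpa using this.2)

theorem pd_hasFDerivWithinAt {f : Pt → ℝ} (hf : ContDiffOn ℝ 1 f slab) {x : Pt} (hx : x ∈ slab) :
    HasFDerivWithinAt f (fderivWithin ℝ f slab x) slab x :=
  ((hf.differentiableOn one_ne_zero) x hx).hasFDerivWithinAt

theorem pd_eq {f : Pt → ℝ} {f' : Pt →L[ℝ] ℝ} {x : Pt} (h : HasFDerivWithinAt f f' slab x)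
    (hx : x ∈ slab) (i : Fin 3) : pd i f x = f' (Pi.single i 1) := by
  rw [pd, h.fderivWithin (uniqueDiffOn_slab x hx)]

theorem contDiffOn_pd {f : Pt → ℝ} (hf : ContDiffOn ℝ 2 f slab) (i : Fin 3) :
    ContDiffOn ℝ 1 (pd i f) slab :=
  (hf.fderivWithin uniqueDiffOn_slab (by norm_num)).clm_apply contDiffOn_const

theorem continuousOn_pd {f : Pt → ℝ} (hf : ContDiffOn ℝ 1 f slab) (i : Fin 3) :
    ContinuousOn (pd i f) slab :=
  (hf.continuousOn_fderivWithin uniqueDiffOn_slab le_rfl).clm_apply continuousOn_const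

theorem pd_add {f g : Pt → ℝ} (hf : ContDiffOn ℝ 1 f slab) (hg : ContDiffOn ℝ 1 g slab)
    {x : Pt} (hx : x ∈ slab) (i : Fin 3) :
    pd i (fun y => f y + g y) x = pd i f x + pd i g x := by
  exact pd_eq ((pd_hasFDerivWithinAt hf hx).add (pd_hasFDerivWithinAt hg hx)) hx i

theorem pd_sub {f g : Pt → ℝ} (hf : ContDiffOn ℝ 1 f slab) (hg : ContDiffOn ℝ 1 g slab)
    {x : Pt} (hx : x ∈ slab) (i : Fin 3) :
    pd i (fun y => f y - g y) x = pd i f x - pd i g x := by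
  exact pd_eq ((pd_hasFDerivWithinAt hf hx).sub (pd_hasFDerivWithinAt hg hx)) hx i

theorem pd_sum {ι : Type*} (s : Finset ι) {f : ι → Pt → ℝ} (hf : ∀ k, ContDiffOn ℝ 1 (f k) slab)
    {x : Pt} (hx : x ∈ slab) (i : Fin 3) :
    pd i (fun y => ∑ k ∈ s, f k y) x = ∑ k ∈ s, pd i (f k) x := by
  rw [pd_eq (HasFDerivWithinAt.fun_sum fun k _ => pd_hasFDerivWithinAt (hf k) hx) hx]
  simp [pd]

theorem pd_mul {f g : Pt → ℝ} (hf : ContDiffOn ℝ 1 f slab) (hg : ContDiffOn ℝ 1 g slab)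
    {x : Pt} (hx : x ∈ slab) (i : Fin 3) :
    pd i (fun y => f y * g y) x = f x * pd i g x + g x * pd i f x := by
  exact pd_eq ((pd_hasFDerivWithinAt hf hx).mul (pd_hasFDerivWithinAt hg hx)) hx i

theorem pd_comp {F : ℝ → ℝ} {F' : ℝ} {f : Pt → ℝ} {x : Pt} (hF : HasDerivAt F F' (f x))
    (hf : ContDiffOn ℝ 1 f slab) (hx : x ∈ slab) (i : Fin 3) :
    pd i (fun y => F (f y)) x = F' * pd i f x := by
  exact pd_eq (hF.comp_hasFDerivWithinAt x (pd_hasFDerivWithinAt hf hx)) hx i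

theorem pd_const (c : ℝ) {x : Pt} (hx : x ∈ slab) (i : Fin 3) : pd i (fun _ => c) x = 0 := by
  rw [pd_eq (hasFDerivWithinAt_const c x slab) hx]; rfl

theorem pd_coord (k : Fin 3) {x : Pt} (hx : x ∈ slab) (i : Fin 3) :
    pd i (fun y => y k) x = if k = i then 1 else 0 := by
  rw [pd_eq (hasFDerivWithinAt_apply k x slab) hx]
  simp [Pi.single_apply]

theorem contDiffOn_coord (k : Fin 3) : ContDiffOn ℝ 1 (fun x : Pt => x k) slab :=
  (contDiff_apply ℝ ℝ k).contDiffOn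

theorem contDiffOn_comp {F : ℝ → ℝ} {f : Pt → ℝ} (hF : ContDiff ℝ 1 F)
    (hf : ContDiffOn ℝ 1 f slab) : ContDiffOn ℝ 1 (fun x => F (f x)) slab :=
  hF.comp_contDiffOn hf

/-! ### Periodicity -/

theorem add_single_mem_slab {x : Pt} {i : Fin 3} (hi : i ≠ 2) (L : ℝ) :
    x + Pi.single i L ∈ slab ↔ x ∈ slab := by
  simp [slab, Pi.single_eq_of_ne hi.symm]

open scoped Pointwise in
theorem pd_add_single {f : Pt → ℝ} {i : Fin 3} (hi : i ≠ 2) {L : ℝ}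
    (h : ∀ x ∈ slab, f (x + Pi.single i L) = f x) (j : Fin 3) {x : Pt} (hx : x ∈ slab) :
    pd j f (x + Pi.single i L) = pd j f x := by
  have hs : (Pi.single i L : Pt) +ᵥ slab = slab := by
    ext y
    rw [Set.mem_vadd_set_iff_neg_vadd_mem, vadd_eq_add, add_comm, ← Pi.single_neg,
      add_single_mem_slab hi]
  have := fderivWithin_comp_add_right (𝕜 := ℝ) (f := f) (s := slab) (x := x) (Pi.single i L : Pt)
  rw [hs] at this
  rw [pd, ← this, pd, fderivWithin_congr (fun y hy => h y hy) (h x hx)]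

namespace HorizPeriodic

variable {Lx Ly : ℝ}

theorem pd {f : Pt → ℝ} (h : HorizPeriodic Lx Ly f) (j : Fin 3) : HorizPeriodic Lx Ly (pd j f) :=
  fun _ hx => ⟨pd_add_single (by decide) (fun y hy => (h y hy).1) j hx,
    pd_add_single (by decide) (fun y hy => (h y hy).2) j hx⟩

theorem comp {F G : Type} {f : Pt → F} (h : HorizPeriodic Lx Ly f) (φ : F → G) :
    HorizPeriodic Lx Ly (fun x => φ (f x)) :=
  fun x hx => ⟨by simp only [(h x hx).1], by simp only [(h x hx).2]⟩

theorem comp₂ {F G H : Type} {f : Pt → F} {g : Pt → G} (hf : HorizPeriodic Lx Ly f)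
    (hg : HorizPeriodic Lx Ly g) (φ : F → G → H) : HorizPeriodic Lx Ly (fun x => φ (f x) (g x)) :=
  fun x hx => ⟨by simp only [(hf x hx).1, (hg x hx).1], by simp only [(hf x hx).2, (hg x hx).2]⟩

theorem sum {ι : Type} (s : Finset ι) {f : ι → Pt → ℝ} (hf : ∀ k, HorizPeriodic Lx Ly (f k)) :
    HorizPeriodic Lx Ly (fun x => ∑ k ∈ s, f k x) :=
  fun x hx => ⟨Finset.sum_congr rfl fun k _ => (hf k x hx).1,
    Finset.sum_congr rfl fun k _ => (hf k x hx).2⟩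

end HorizPeriodic

/-! ### The divergence theorem on a period cell -/

theorem integral_div_nonpos {Lx Ly : ℝ} (hLx : 0 < Lx) (hLy : 0 < Ly) {V : Fin 3 → Pt → ℝ}
    (hV : ∀ j, ContDiffOn ℝ 1 (V j) slab) (hper : ∀ j, HorizPeriodic Lx Ly (V j))
    (hbot : ∀ x : Pt, x 2 = 0 → 0 ≤ V 2 x) (htop : ∀ x : Pt, x 2 = 1 → V 2 x ≤ 0) :
    ∫ x in cell Lx Ly, ∑ j, pd j (V j) x ≤ 0 := by
  have hle : (0 : Pt) ≤ ![Lx, Ly, 1] := by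
    intro i; fin_cases i <;> simp [hLx.le, hLy.le]
  have key := integral_divergence_of_hasFDerivAt_off_countable' (0 : Pt) ![Lx, Ly, 1] hle V
    (fun j x => fderivWithin ℝ (V j) slab x) ∅ Set.countable_empty
    (fun j => (hV j).continuousOn.mono (cell_subset_slab Lx Ly))
    (fun x hx j => by
      have := hx.1 2 trivial
      simp only [Set.mem_Ioo] at this
      have hn : slab ∈ 𝓝 x := slab_mem_nhds this.1 (by simpa using this.2)
      exact (pd_hasFDerivWithinAt (hV j) (mem_of_mem_nhds hn)).hasFDerivAt hn)
    (integrableOn_cell (continuousOn_finsetSum _ fun j _ => continuousOn_pd (hV j) j) Lx Ly)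
  change ∫ x in cell Lx Ly, ∑ j, pd j (V j) x = _ at key
  rw [key]
  have hface : ∀ i : Fin 3, i ≠ 2 → (∀ x ∈ slab,
      V i (x + Pi.single i ((![Lx, Ly, 1] : Pt) i)) = V i x) →
      ((∫ x in Set.Icc ((0 : Pt) ∘ Fin.succAbove i) ((![Lx, Ly, 1] : Pt) ∘ Fin.succAbove i),
        V i (Fin.insertNth i ((![Lx, Ly, 1] : Pt) i) x)) -
      ∫ x in Set.Icc ((0 : Pt) ∘ Fin.succAbove i) ((![Lx, Ly, 1] : Pt) ∘ Fin.succAbove i),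
        V i (Fin.insertNth i ((0 : Pt) i) x)) = 0 := by
    intro i hi hp
    rw [sub_eq_zero]
    refine setIntegral_congr_fun measurableSet_Icc fun x hx => ?_
    have hm : (Fin.insertNth i ((0 : Pt) i) x : Pt) ∈ slab := by
      refine cell_subset_slab Lx Ly ?_
      rw [cell, Fin.insertNth_mem_Icc]
      exact ⟨⟨le_rfl, hle i⟩, hx⟩
    have := hp _ hm
    rw [← this]
    congr 1
    refine Fin.insertNth_eq_iff.2 ⟨?_, ?_⟩
    · simp
    · ext k
      simp [Fin.removeNth]
  rw [Fin.sum_univ_three, hface 0 (by decide) fun x hx => (hper 0 x hx).1,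
    hface 1 (by decide) fun x hx => (hper 1 x hx).2, zero_add, zero_add, sub_nonpos]
  refine (setIntegral_nonpos measurableSet_Icc fun x _ => ?_).trans
    (setIntegral_nonneg measurableSet_Icc fun x _ => ?_)
  · exact htop _ (by simp)
  · exact hbot _ (by simp)

/-! ### Poincaré inequalities -/

theorem integral_sq_le_of_eq_zero_bottom {Lx Ly : ℝ} (hLx : 0 < Lx) (hLy : 0 < Ly) {f : Pt → ℝ}
    (hf : ContDiffOn ℝ 1 f slab) (hper : HorizPeriodic Lx Ly f)
    (h0 : ∀ x : Pt, x 2 = 0 → f x = 0) :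
    ∫ x in cell Lx Ly, f x ^ 2 ≤ 4 * ∫ x in cell Lx Ly, pd 2 f x ^ 2 := by
  have hz : ContDiffOn ℝ 1 (fun x : Pt => x 2 - 1) slab :=
    (contDiffOn_coord 2).sub contDiffOn_const
  have hg : ContDiffOn ℝ 1 (fun x : Pt => f x * f x) slab := hf.mul hf
  have hw : ContDiffOn ℝ 1 (fun x : Pt => (x 2 - 1) * (f x * f x)) slab := hz.mul hg
  have hdiv := integral_div_nonpos hLx hLy
    (V := ![fun _ => 0, fun _ => 0, fun x => (x 2 - 1) * (f x * f x)])
    (by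
      intro j; fin_cases j
      exacts [contDiffOn_const, contDiffOn_const, hw])
    (by
      intro j; fin_cases j
      · exact fun x _ => ⟨rfl, rfl⟩
      · exact fun x _ => ⟨rfl, rfl⟩
      · intro x hx
        have := hper x hx
        exact ⟨by simp [this.1], by simp [this.2]⟩)
    (fun x hx => by simp [h0 x hx]) (fun x hx => by simp [hx])
  have hpt : ∀ x ∈ cell Lx Ly, (1 / 2) * f x ^ 2 - 2 * pd 2 f x ^ 2 ≤
      ∑ j, pd j ((![fun _ => 0, fun _ => 0, fun x => (x 2 - 1) * (f x * f x)] :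
        Fin 3 → Pt → ℝ) j) x := by
    intro x hx
    have hs := cell_subset_slab Lx Ly hx
    have e1 : pd 2 (fun x : Pt => x 2 - 1) x = 1 := by
      rw [pd_sub (contDiffOn_coord 2) contDiffOn_const hs, pd_coord 2 hs, pd_const _ hs]; simp
    simp only [Fin.sum_univ_three, Matrix.cons_val_zero, Matrix.cons_val_one, Matrix.cons_val,
      pd_const _ hs]
    rw [pd_mul hz hg hs, pd_mul hf hf hs, e1]
    have h1 : 0 ≤ 1 - x 2 := sub_nonneg.2 hs.2
    have h2 : 1 - x 2 ≤ 1 := by linarith [hs.1]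
    nlinarith [sq_nonneg (f x - 2 * (1 - x 2) * pd 2 f x),
      mul_nonneg (sq_nonneg (pd 2 f x)) (show 0 ≤ 1 - (1 - x 2) ^ 2 by nlinarith)]
  have i1 : IntegrableOn (fun x => f x ^ 2) (cell Lx Ly) :=
    integrableOn_cell (hf.continuousOn.pow 2) Lx Ly
  have i2 : IntegrableOn (fun x => pd 2 f x ^ 2) (cell Lx Ly) :=
    integrableOn_cell ((continuousOn_pd hf 2).pow 2) Lx Ly
  have hmono := setIntegral_mono_on ((i1.const_mul (1 / 2)).sub (i2.const_mul 2))
    (integrableOn_cell (continuousOn_finsetSum _ fun j _ => continuousOn_pd (by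
      fin_cases j
      exacts [contDiffOn_const, contDiffOn_const, hw]) j) Lx Ly) (measurableSet_cell Lx Ly) hpt
  rw [integral_sub' (i1.const_mul (1 / 2)) (i2.const_mul 2), integral_const_mul,
    integral_const_mul] at hmono
  linarith

theorem sq_sub_le_mul_integral_sq {L : ℝ} (hL : 0 < L) {φ φ' : ℝ → ℝ}
    (hφ : ContinuousOn φ (Set.Icc 0 L)) (hφ' : ContinuousOn φ' (Set.Icc 0 L))
    (hd : ∀ s ∈ Set.Ioo 0 L, HasDerivAt φ (φ' s) s) {s t : ℝ} (hs : s ∈ Set.Icc 0 L)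
    (ht : t ∈ Set.Icc 0 L) : (φ s - φ t) ^ 2 ≤ L * ∫ r in Set.Icc 0 L, φ' r ^ 2 := by
  have ha : IntegrableOn (fun r => |φ' r|) (Set.Icc 0 L) :=
    hφ'.abs.integrableOn_compact isCompact_Icc
  have hsq : IntegrableOn (fun r => φ' r ^ 2) (Set.Icc 0 L) :=
    (hφ'.pow 2).integrableOn_compact isCompact_Icc
  set I := ∫ r in Set.Icc 0 L, |φ' r| with hI
  have hdiff : |φ s - φ t| ≤ I := by
    wlog hst : t ≤ s generalizing s t
    · rw [abs_sub_comm]; exact this ht hs (le_of_not_ge hst)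
    have hsub : Set.Icc t s ⊆ Set.Icc 0 L := Set.Icc_subset_Icc ht.1 hs.2
    have hint : IntervalIntegrable φ' volume t s :=
      (hφ'.mono (by rwa [Set.uIcc_of_le hst])).intervalIntegrable
    rw [← intervalIntegral.integral_eq_sub_of_hasDerivAt_of_le hst (hφ.mono hsub)
      (fun r hr => hd r ⟨ht.1.trans_lt hr.1, hr.2.trans_le hs.2⟩) hint]
    refine (intervalIntegral.abs_integral_le_integral_abs hst).trans ?_
    rw [intervalIntegral.integral_of_le hst]
    exact setIntegral_mono_set ha (ae_of_all _ fun r => abs_nonneg _)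
      ((Set.Ioc_subset_Icc_self.trans hsub).eventuallyLE)
  have hcs : I ^ 2 ≤ L * ∫ r in Set.Icc 0 L, φ' r ^ 2 := by
    have h0 : 0 ≤ ∫ r in Set.Icc 0 L, (|φ' r| - I / L) ^ 2 :=
      integral_nonneg fun r => sq_nonneg _
    have e : ∀ r, (|φ' r| - I / L) ^ 2 = φ' r ^ 2 - 2 * (I / L) * |φ' r| + (I / L) ^ 2 := by
      intro r; rw [sub_sq, sq_abs]; ring
    simp_rw [e] at h0
    have ha' : IntegrableOn (fun r => 2 * (I / L) * |φ' r|) (Set.Icc 0 L) := ha.const_mul _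
    have hs' : IntegrableOn (fun r => φ' r ^ 2 - 2 * (I / L) * |φ' r|) (Set.Icc 0 L) :=
      hsq.sub ha'
    rw [integral_add hs' (integrable_const _), integral_sub hsq ha', integral_const_mul, ← hI,
      integral_const] at h0
    simp only [measureReal_restrict_apply_univ, Real.volume_real_Icc_of_le hL.le, sub_zero,
      smul_eq_mul] at h0
    have : L * (I / L) ^ 2 = I ^ 2 / L := by field_simp
    rw [this] at h0
    have h3 : 2 * (I / L) * I = 2 * (I ^ 2 / L) := by ring
    rw [h3] at h0
    have : I ^ 2 / L ≤ ∫ r in Set.Icc 0 L, φ' r ^ 2 := by linarith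
    rwa [div_le_iff₀' hL] at this
  calc (φ s - φ t) ^ 2 = |φ s - φ t| ^ 2 := (sq_abs _).symm
    _ ≤ I ^ 2 := pow_le_pow_left₀ (abs_nonneg _) hdiff 2
    _ ≤ _ := hcs

theorem lintegral_sq_sub_le {L : ℝ} (hL : 0 < L) {φ φ' : ℝ → ℝ}
    (hφ : ContinuousOn φ (Set.Icc 0 L)) (hφ' : ContinuousOn φ' (Set.Icc 0 L))
    (hd : ∀ s ∈ Set.Ioo 0 L, HasDerivAt φ (φ' s) s) :
    ∫⁻ s in Set.Icc 0 L, ∫⁻ t in Set.Icc 0 L, ENNReal.ofReal ((φ s - φ t) ^ 2) ≤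
      ENNReal.ofReal (L ^ 3) * ∫⁻ r in Set.Icc 0 L, ENNReal.ofReal (φ' r ^ 2) := by
  have hsq : IntegrableOn (fun r => φ' r ^ 2) (Set.Icc 0 L) :=
    (hφ'.pow 2).integrableOn_compact isCompact_Icc
  rw [← ofReal_integral_eq_lintegral_ofReal hsq (ae_of_all _ fun r => sq_nonneg _),
    ← ENNReal.ofReal_mul (by positivity)]
  calc ∫⁻ s in Set.Icc 0 L, ∫⁻ t in Set.Icc 0 L, ENNReal.ofReal ((φ s - φ t) ^ 2)
      ≤ ∫⁻ _ in Set.Icc 0 L, ∫⁻ _ in Set.Icc 0 L,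
          ENNReal.ofReal (L * ∫ r in Set.Icc 0 L, φ' r ^ 2) :=
        setLIntegral_mono' measurableSet_Icc fun s hs =>
          setLIntegral_mono' measurableSet_Icc fun t ht =>
            ENNReal.ofReal_le_ofReal (sq_sub_le_mul_integral_sq hL hφ hφ' hd hs ht)
    _ = _ := by
        simp only [lintegral_const, Measure.restrict_apply_univ, Real.volume_Icc, sub_zero]
        have h0 : 0 ≤ ∫ r in Set.Icc 0 L, φ' r ^ 2 := integral_nonneg fun r => sq_nonneg _
        rw [← ENNReal.ofReal_mul (by positivity), ← ENNReal.ofReal_mul (by positivity)]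
        congr 1; ring

theorem lintegral_sq_sub_prod_le {α β : Type*} [MeasurableSpace α] [MeasurableSpace β]
    (μ : Measure α) (ν : Measure β) [SFinite μ] [SFinite ν] {f : α × β → ℝ} (hf : Measurable f) :
    ∫⁻ p, ∫⁻ q, ENNReal.ofReal ((f p - f q) ^ 2) ∂(μ.prod ν) ∂(μ.prod ν) ≤
      2 * ν Set.univ * ∫⁻ b, ∫⁻ a, ∫⁻ a', ENNReal.ofReal ((f (a, b) - f (a', b)) ^ 2) ∂μ ∂μ ∂ν +
      2 * μ Set.univ * ∫⁻ a, ∫⁻ b, ∫⁻ b', ENNReal.ofReal ((f (a, b) - f (a, b')) ^ 2) ∂ν ∂ν ∂μ := by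
  set X : α → β → α → ℝ≥0∞ := fun a b a' => ENNReal.ofReal ((f (a, b) - f (a', b)) ^ 2) with hX
  set Y : β → α → β → ℝ≥0∞ := fun b a' b' => ENNReal.ofReal ((f (a', b) - f (a', b')) ^ 2) with hY
  have mX : Measurable fun r : (α × β) × α => X r.1.1 r.1.2 r.2 := by
    simp only [hX]; fun_prop
  have mY : Measurable fun r : (β × α) × β => Y r.1.1 r.1.2 r.2 := by
    simp only [hY]; fun_prop
  have mX1 : Measurable fun p : α × β => ∫⁻ a', X p.1 p.2 a' ∂μ := mX.lintegral_prod_right'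
  have mY1 : Measurable fun p : β × α => ∫⁻ b', Y p.1 p.2 b' ∂ν := mY.lintegral_prod_right'
  have mY2 : Measurable fun b : β => ∫⁻ a', ∫⁻ b', Y b a' b' ∂ν ∂μ := mY1.lintegral_prod_right'
  have mY3 : Measurable fun p : α × β => ∫⁻ a', ∫⁻ b', Y p.2 a' b' ∂ν ∂μ := mY2.comp measurable_snd
  have hpt : ∀ a b a' b', ENNReal.ofReal ((f (a, b) - f (a', b')) ^ 2) ≤
      2 * X a b a' + 2 * Y b a' b' := by
    intro a b a' b'
    simp only [hX, hY]
    rw [← ENNReal.ofReal_ofNat 2, ← ENNReal.ofReal_mul (by norm_num),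
      ← ENNReal.ofReal_mul (by norm_num), ← ENNReal.ofReal_add (by positivity) (by positivity)]
    refine ENNReal.ofReal_le_ofReal ?_
    nlinarith [sq_nonneg ((f (a, b) - f (a', b)) - (f (a', b) - f (a', b')))]
  have hinner : ∀ a b, ∫⁻ q, ENNReal.ofReal ((f (a, b) - f q) ^ 2) ∂(μ.prod ν) ≤
      2 * ν Set.univ * ∫⁻ a', X a b a' ∂μ + 2 * ∫⁻ a', ∫⁻ b', Y b a' b' ∂ν ∂μ := by
    intro a b
    rw [lintegral_prod _ (by fun_prop)]
    calc ∫⁻ a', ∫⁻ b', ENNReal.ofReal ((f (a, b) - f (a', b')) ^ 2) ∂ν ∂μ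
        ≤ ∫⁻ a', ∫⁻ b', (2 * X a b a' + 2 * Y b a' b') ∂ν ∂μ :=
          lintegral_mono fun a' => lintegral_mono fun b' => hpt a b a' b'
      _ = ∫⁻ a', (2 * ν Set.univ * X a b a' + 2 * ∫⁻ b', Y b a' b' ∂ν) ∂μ := by
          refine lintegral_congr fun a' => ?_
          rw [lintegral_add_left measurable_const, lintegral_const, lintegral_const_mul]
          · ring
          · simp only [hY]; fun_prop
      _ = _ := by
          have m1 : Measurable fun a' => X a b a' := by simp only [hX]; fun_prop
          have m2 : Measurable fun a' => ∫⁻ b', Y b a' b' ∂ν :=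
            Measurable.of_uncurry_left (f := fun b a' => ∫⁻ b', Y b a' b' ∂ν) mY1
          rw [lintegral_add_left (m1.const_mul _), lintegral_const_mul _ m1,
            lintegral_const_mul _ m2]
  calc ∫⁻ p, ∫⁻ q, ENNReal.ofReal ((f p - f q) ^ 2) ∂(μ.prod ν) ∂(μ.prod ν)
      ≤ ∫⁻ p, (2 * ν Set.univ * ∫⁻ a', X p.1 p.2 a' ∂μ +
          2 * ∫⁻ a', ∫⁻ b', Y p.2 a' b' ∂ν ∂μ) ∂(μ.prod ν) :=
        lintegral_mono fun p => hinner p.1 p.2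
    _ = 2 * ν Set.univ * ∫⁻ p, ∫⁻ a', X p.1 p.2 a' ∂μ ∂(μ.prod ν) +
          2 * ∫⁻ p, ∫⁻ a', ∫⁻ b', Y p.2 a' b' ∂ν ∂μ ∂(μ.prod ν) := by
        rw [lintegral_add_left (mX1.const_mul _), lintegral_const_mul _ mX1,
          lintegral_const_mul _ mY3]
    _ = _ := by
        congr 1
        · rw [lintegral_prod_symm _ mX1.aemeasurable]
        · rw [lintegral_prod _ mY3.aemeasurable]
          change 2 * ∫⁻ _ : α, ∫⁻ b, ∫⁻ a', ∫⁻ b', Y b a' b' ∂ν ∂μ ∂ν ∂μ = _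
          rw [lintegral_const, lintegral_lintegral_swap mY1.aemeasurable]
          ring

theorem cell_eq_pi (Lx Ly : ℝ) :
    cell Lx Ly = Set.pi Set.univ fun i : Fin 3 => Set.Icc (0 : ℝ) ((![Lx, Ly, 1] : Pt) i) :=
  (Set.pi_univ_Icc (0 : Pt) ![Lx, Ly, 1]).symm

theorem measurePreserving_cell (Lx Ly : ℝ) :
    MeasurePreserving (fun x : Pt => (x 0, x 1, x 2)) (volume.restrict (cell Lx Ly))
      ((volume.restrict (Set.Icc 0 Lx)).prod
        ((volume.restrict (Set.Icc 0 Ly)).prod (volume.restrict (Set.Icc (0 : ℝ) 1)))) := by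
  set μ : Fin 3 → Measure ℝ :=
    fun i => volume.restrict (Set.Icc (0 : ℝ) ((![Lx, Ly, 1] : Pt) i)) with hμ
  have e1 : volume.restrict (cell Lx Ly) = Measure.pi μ := by
    rw [cell_eq_pi, volume_pi, Measure.restrict_pi_pi]
  have h1 := measurePreserving_piFinSuccAbove μ 0
  have h2 := measurePreserving_piFinTwo (fun j => μ ((0 : Fin 3).succAbove j))
  rw [e1]
  exact ((MeasurePreserving.id (μ 0)).prod h2).comp h1

theorem lintegral_cell_eq_prod (Lx Ly : ℝ) {g : Pt → ℝ≥0∞} (hg : Measurable g) :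
    ∫⁻ x in cell Lx Ly, g x = ∫⁻ p, g ![p.1, p.2.1, p.2.2]
      ∂((volume.restrict (Set.Icc 0 Lx)).prod
        ((volume.restrict (Set.Icc 0 Ly)).prod (volume.restrict (Set.Icc (0 : ℝ) 1)))) := by
  have hm : Measurable fun p : ℝ × ℝ × ℝ => g ![p.1, p.2.1, p.2.2] := by
    refine hg.comp (measurable_pi_iff.2 fun i => ?_)
    fin_cases i
    · exact measurable_fst
    · exact measurable_snd.fst
    · exact measurable_snd.snd
  rw [← (measurePreserving_cell Lx Ly).lintegral_comp hm]
  refine lintegral_congr fun x => ?_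
  congr 1
  ext i; fin_cases i <;> rfl

/-- Projection of space to the layer, along the vertical. -/
noncomputable def clampPt (x : Pt) : Pt := ![x 0, x 1, max 0 (min 1 (x 2))]

theorem continuous_clampPt : Continuous clampPt := by
  refine continuous_pi fun i => ?_
  fin_cases i
  · exact continuous_apply 0
  · exact continuous_apply 1
  · exact continuous_const.max (continuous_const.min (continuous_apply 2))

theorem clampPt_mem (x : Pt) : clampPt x ∈ slab :=
  ⟨le_max_left _ _, max_le zero_le_one (min_le_left _ _)⟩

theorem clampPt_of_mem {x : Pt} (hx : x ∈ slab) : clampPt x = x := by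
  ext i; fin_cases i
  · rfl
  · rfl
  · change max 0 (min 1 (x 2)) = x 2
    rw [min_eq_right hx.2, max_eq_right hx.1]

theorem continuous_comp_clampPt {f : Pt → ℝ} (hf : ContinuousOn f slab) :
    Continuous fun x => f (clampPt x) :=
  hf.comp_continuous continuous_clampPt clampPt_mem

theorem hasDerivAt_comp_line {f : Pt → ℝ} (hf : ContDiffOn ℝ 1 f slab) {γ : ℝ → Pt} {s : ℝ}
    {i : Fin 3} (hγ : HasDerivAt γ (Pi.single i 1) s) (hm : ∀ᶠ r in 𝓝 s, γ r ∈ slab) :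
    HasDerivAt (fun r => f (γ r)) (pd i f (γ s)) s := by
  have h := (pd_hasFDerivWithinAt hf hm.self_of_nhds).comp_hasDerivWithinAt s
    (hγ.hasDerivWithinAt (s := γ ⁻¹' slab)) (fun _ h => h)
  exact h.hasDerivAt hm

theorem hasDerivAt_slice_zero {f : Pt → ℝ} (hf : ContDiffOn ℝ 1 f slab) (s y z : ℝ) :
    HasDerivAt (fun r => f (clampPt ![r, y, z])) (pd 0 f (clampPt ![s, y, z])) s := by
  refine hasDerivAt_comp_line hf (γ := fun r => clampPt ![r, y, z]) (hasDerivAt_pi.2 fun i => ?_)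
    (.of_forall fun r => clampPt_mem _)
  fin_cases i
  · exact hasDerivAt_id s
  · exact hasDerivAt_const s y
  · exact hasDerivAt_const s (max 0 (min 1 z))

theorem hasDerivAt_slice_one {f : Pt → ℝ} (hf : ContDiffOn ℝ 1 f slab) (s x z : ℝ) :
    HasDerivAt (fun r => f (clampPt ![x, r, z])) (pd 1 f (clampPt ![x, s, z])) s := by
  refine hasDerivAt_comp_line hf (γ := fun r => clampPt ![x, r, z]) (hasDerivAt_pi.2 fun i => ?_)
    (.of_forall fun r => clampPt_mem _)
  fin_cases i
  · exact hasDerivAt_const s x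
  · exact hasDerivAt_id s
  · exact hasDerivAt_const s (max 0 (min 1 z))

theorem hasDerivAt_slice_two {f : Pt → ℝ} (hf : ContDiffOn ℝ 1 f slab) {s : ℝ} (x y : ℝ)
    (hs : s ∈ Set.Ioo (0 : ℝ) 1) :
    HasDerivAt (fun r => f (clampPt ![x, y, r])) (pd 2 f (clampPt ![x, y, s])) s := by
  refine hasDerivAt_comp_line hf (γ := fun r => clampPt ![x, y, r]) (hasDerivAt_pi.2 fun i => ?_)
    (.of_forall fun r => clampPt_mem _)
  fin_cases i
  · exact hasDerivAt_const s x
  · exact hasDerivAt_const s y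
  · refine (hasDerivAt_id s).congr_of_eventuallyEq ?_
    filter_upwards [Ioo_mem_nhds hs.1 hs.2] with r hr
    change max 0 (min 1 r) = r
    rw [min_eq_right hr.2.le, max_eq_right hr.1.le]

theorem continuous_vec3 : Continuous fun p : ℝ × ℝ × ℝ => (![p.1, p.2.1, p.2.2] : Pt) := by
  refine continuous_pi fun i => ?_
  fin_cases i
  · exact continuous_fst
  · exact continuous_snd.fst
  · exact continuous_snd.snd

theorem lintegral_sq_sub_cell_le {Lx Ly : ℝ} (hLx : 0 < Lx) (hLy : 0 < Ly) {f : Pt → ℝ}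
    (hf : ContDiffOn ℝ 1 f slab) :
    ∫⁻ a in cell Lx Ly, ∫⁻ b in cell Lx Ly, ENNReal.ofReal ((f a - f b) ^ 2) ≤
      ENNReal.ofReal (2 * Ly * Lx ^ 3) * (∫⁻ a in cell Lx Ly, ENNReal.ofReal (pd 0 f a ^ 2)) +
      (ENNReal.ofReal (4 * Lx * Ly ^ 3) * (∫⁻ a in cell Lx Ly, ENNReal.ofReal (pd 1 f a ^ 2)) +
      ENNReal.ofReal (4 * Lx * Ly) * ∫⁻ a in cell Lx Ly, ENNReal.ofReal (pd 2 f a ^ 2)) := by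
  set G : ℝ × ℝ × ℝ → ℝ := fun p => f (clampPt ![p.1, p.2.1, p.2.2]) with hG
  set Q : Fin 3 → ℝ × ℝ × ℝ → ℝ := fun i p => pd i f (clampPt ![p.1, p.2.1, p.2.2]) with hQ
  have cG : Continuous G := (continuous_comp_clampPt hf.continuousOn).comp continuous_vec3
  have cQ : ∀ i, Continuous (Q i) := fun i =>
    (continuous_comp_clampPt (continuousOn_pd hf i)).comp continuous_vec3
  have mQ : ∀ i, Measurable fun p => ENNReal.ofReal (Q i p ^ 2) := fun i =>
    ((cQ i).measurable.pow_const 2).ennreal_ofReal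
  set ν₀ : Measure ℝ := volume.restrict (Set.Icc 0 Lx) with hν₀
  set ν₁ : Measure ℝ := volume.restrict (Set.Icc 0 Ly) with hν₁
  set ν₂ : Measure ℝ := volume.restrict (Set.Icc (0 : ℝ) 1) with hν₂
  have v₀ : ν₀ Set.univ = ENNReal.ofReal Lx := by simp [hν₀]
  have v₁ : ν₁ Set.univ = ENNReal.ofReal Ly := by simp [hν₁]
  have v₂ : ν₂ Set.univ = 1 := by simp [hν₂]
  have hcl : ∀ x ∈ cell Lx Ly, clampPt x = x := fun x hx =>
    clampPt_of_mem (cell_subset_slab Lx Ly hx)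
  have hJ : ∀ i, ∫⁻ a in cell Lx Ly, ENNReal.ofReal (pd i f a ^ 2) =
      ∫⁻ p, ENNReal.ofReal (Q i p ^ 2) ∂(ν₀.prod (ν₁.prod ν₂)) := by
    intro i
    rw [← lintegral_cell_eq_prod Lx Ly (g := fun x => ENNReal.ofReal (pd i f (clampPt x) ^ 2))
      ((continuous_comp_clampPt (continuousOn_pd hf i)).measurable.pow_const 2).ennreal_ofReal]
    exact setLIntegral_congr_fun (measurableSet_cell Lx Ly) fun x hx => by
      simp only [hcl x hx]
  have hD : ∫⁻ a in cell Lx Ly, ∫⁻ b in cell Lx Ly, ENNReal.ofReal ((f a - f b) ^ 2) =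
      ∫⁻ p, ∫⁻ q, ENNReal.ofReal ((G p - G q) ^ 2) ∂(ν₀.prod (ν₁.prod ν₂))
        ∂(ν₀.prod (ν₁.prod ν₂)) := by
    have cf := continuous_comp_clampPt hf.continuousOn
    have hm : Measurable fun r : Pt × Pt =>
        ENNReal.ofReal ((f (clampPt r.1) - f (clampPt r.2)) ^ 2) :=
      (((cf.comp continuous_fst).sub (cf.comp continuous_snd)).pow 2).measurable.ennreal_ofReal
    have e1 : ∫⁻ a in cell Lx Ly, ∫⁻ b in cell Lx Ly, ENNReal.ofReal ((f a - f b) ^ 2) =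
        ∫⁻ a in cell Lx Ly, ∫⁻ b in cell Lx Ly,
          ENNReal.ofReal ((f (clampPt a) - f (clampPt b)) ^ 2) :=
      setLIntegral_congr_fun (measurableSet_cell Lx Ly) fun a ha =>
        setLIntegral_congr_fun (measurableSet_cell Lx Ly) fun b hb => by
          simp only [hcl a ha, hcl b hb]
    rw [e1, lintegral_cell_eq_prod Lx Ly hm.lintegral_prod_right']
    refine lintegral_congr fun p => ?_
    exact lintegral_cell_eq_prod Lx Ly
      (Measurable.of_uncurry_left (f := fun a b =>
        ENNReal.ofReal ((f (clampPt a) - f (clampPt b)) ^ 2)) hm)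
  rw [hD, hJ, hJ, hJ]
  have b0 : ∫⁻ b, ∫⁻ a, ∫⁻ a', ENNReal.ofReal ((G (a, b) - G (a', b)) ^ 2) ∂ν₀ ∂ν₀ ∂(ν₁.prod ν₂) ≤
      ENNReal.ofReal (Lx ^ 3) *
        ∫⁻ p, ENNReal.ofReal (Q 0 p ^ 2) ∂(ν₀.prod (ν₁.prod ν₂)) := by
    rw [lintegral_prod_symm _ (mQ 0).aemeasurable,
      ← lintegral_const_mul _ (mQ 0).lintegral_prod_left']
    refine lintegral_mono fun b => ?_
    exact lintegral_sq_sub_le hLx (φ := fun s => G (s, b)) (φ' := fun s => Q 0 (s, b))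
      (by fun_prop) (((cQ 0).comp (by fun_prop)).continuousOn)
      (fun s _ => hasDerivAt_slice_zero hf s b.1 b.2)
  have b1 : ∀ a, ∫⁻ z, ∫⁻ y, ∫⁻ y', ENNReal.ofReal ((G (a, y, z) - G (a, y', z)) ^ 2) ∂ν₁ ∂ν₁ ∂ν₂ ≤
      ENNReal.ofReal (Ly ^ 3) * ∫⁻ p, ENNReal.ofReal (Q 1 (a, p) ^ 2) ∂(ν₁.prod ν₂) := by
    intro a
    have m : Measurable fun p : ℝ × ℝ => ENNReal.ofReal (Q 1 (a, p) ^ 2) :=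
      (mQ 1).comp (measurable_const.prodMk measurable_id)
    rw [lintegral_prod_symm _ m.aemeasurable, ← lintegral_const_mul _ m.lintegral_prod_left']
    refine lintegral_mono fun z => ?_
    exact lintegral_sq_sub_le hLy (φ := fun s => G (a, s, z)) (φ' := fun s => Q 1 (a, s, z))
      (by fun_prop) (((cQ 1).comp (by fun_prop)).continuousOn)
      (fun s _ => hasDerivAt_slice_one hf s a z)
  have b2 : ∀ a, ∫⁻ y, ∫⁻ z, ∫⁻ z', ENNReal.ofReal ((G (a, y, z) - G (a, y, z')) ^ 2) ∂ν₂ ∂ν₂ ∂ν₁ ≤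
      ∫⁻ p, ENNReal.ofReal (Q 2 (a, p) ^ 2) ∂(ν₁.prod ν₂) := by
    intro a
    have m : Measurable fun p : ℝ × ℝ => ENNReal.ofReal (Q 2 (a, p) ^ 2) :=
      (mQ 2).comp (measurable_const.prodMk measurable_id)
    rw [lintegral_prod _ m.aemeasurable]
    refine lintegral_mono fun y => ?_
    have := lintegral_sq_sub_le one_pos (φ := fun s => G (a, y, s)) (φ' := fun s => Q 2 (a, y, s))
      (by fun_prop) (((cQ 2).comp (by fun_prop)).continuousOn)
      (fun s hs => hasDerivAt_slice_two hf a y hs)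
    simpa using this
  have b12 : ∫⁻ a, ∫⁻ b, ∫⁻ b', ENNReal.ofReal ((G (a, b) - G (a, b')) ^ 2)
        ∂(ν₁.prod ν₂) ∂(ν₁.prod ν₂) ∂ν₀ ≤
      2 * ENNReal.ofReal (Ly ^ 3) *
        ∫⁻ p, ENNReal.ofReal (Q 1 p ^ 2) ∂(ν₀.prod (ν₁.prod ν₂)) +
      2 * ENNReal.ofReal Ly * ∫⁻ p, ENNReal.ofReal (Q 2 p ^ 2) ∂(ν₀.prod (ν₁.prod ν₂)) := by
    rw [lintegral_prod _ (mQ 1).aemeasurable, lintegral_prod _ (mQ 2).aemeasurable,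
      ← lintegral_const_mul _ (mQ 1).lintegral_prod_right',
      ← lintegral_const_mul _ (mQ 2).lintegral_prod_right',
      ← lintegral_add_left ((mQ 1).lintegral_prod_right'.const_mul _)]
    refine lintegral_mono fun a => ?_
    refine (lintegral_sq_sub_prod_le ν₁ ν₂ (f := fun b => G (a, b))
      (by fun_prop)).trans ?_
    rw [v₁, v₂, mul_one, mul_assoc 2 (ENNReal.ofReal (Ly ^ 3))]
    exact add_le_add (mul_le_mul_right (b1 a) 2) (mul_le_mul_right (b2 a) _)
  refine (lintegral_sq_sub_prod_le ν₀ (ν₁.prod ν₂) cG.measurable).trans ?_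
  rw [← Set.univ_prod_univ, Measure.prod_prod, v₀, v₁, v₂, mul_one]
  refine (add_le_add (mul_le_mul_right b0 _) (mul_le_mul_right b12 _)).trans (le_of_eq ?_)
  have e2 : (2 : ℝ≥0∞) = ENNReal.ofReal 2 := by simp
  have e4 : (4 : ℝ≥0∞) = ENNReal.ofReal 4 := by simp
  rw [ENNReal.ofReal_mul (by positivity), ENNReal.ofReal_mul (by positivity),
    ENNReal.ofReal_mul (p := 4 * Lx) (by positivity), ENNReal.ofReal_mul (p := 4) (by positivity),
    ENNReal.ofReal_mul (p := 4 * Lx) (by positivity), ENNReal.ofReal_mul (p := 4) (by positivity),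
    ← e2, ← e4]
  ring

theorem volume_real_cell {Lx Ly : ℝ} (hLx : 0 < Lx) (hLy : 0 < Ly) :
    volume.real (cell Lx Ly) = Lx * Ly := by
  have hle : (0 : Pt) ≤ ![Lx, Ly, 1] := by
    intro i; fin_cases i <;> simp [hLx.le, hLy.le]
  rw [Measure.real, cell, Real.volume_Icc_pi_toReal hle]
  simp [Fin.prod_univ_three]

theorem integral_sq_le_of_integral {Lx Ly : ℝ} (hLx : 0 < Lx) (hLy : 0 < Ly) :
    ∃ K > 0, ∀ f : Pt → ℝ, ContDiffOn ℝ 1 f slab →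
      ∫ x in cell Lx Ly, f x ^ 2 ≤ K * ((∫ x in cell Lx Ly, f x) ^ 2 +
        ∫ x in cell Lx Ly, ∑ i, pd i f x ^ 2) := by
  refine ⟨(1 + (2 * Ly * Lx ^ 3 + 4 * Lx * Ly ^ 3 + 4 * Lx * Ly)) / (Lx * Ly), by positivity,
    fun f hf => ?_⟩
  have key := lintegral_sq_sub_cell_le hLx hLy hf
  have i1 : IntegrableOn f (cell Lx Ly) := integrableOn_cell hf.continuousOn Lx Ly
  have i2 : IntegrableOn (fun x => f x ^ 2) (cell Lx Ly) :=
    integrableOn_cell (hf.continuousOn.pow 2) Lx Ly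
  have iq : ∀ i, IntegrableOn (fun x => pd i f x ^ 2) (cell Lx Ly) := fun i =>
    integrableOn_cell ((continuousOn_pd hf i).pow 2) Lx Ly
  have nq : ∀ i, 0 ≤ ∫ x in cell Lx Ly, pd i f x ^ 2 := fun i =>
    integral_nonneg fun x => sq_nonneg _
  have hq : ∀ i, ∫⁻ x in cell Lx Ly, ENNReal.ofReal (pd i f x ^ 2) =
      ENNReal.ofReal (∫ x in cell Lx Ly, pd i f x ^ 2) := fun i =>
    (ofReal_integral_eq_lintegral_ofReal (iq i) (ae_of_all _ fun x => sq_nonneg _)).symm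
  have := isFiniteMeasure_cell Lx Ly
  set m := ∫ x in cell Lx Ly, f x with hm
  set S := ∫ x in cell Lx Ly, f x ^ 2 with hS
  have hint : ∀ α β γ : ℝ, IntegrableOn (fun x => α * f x ^ 2 - β * f x + γ) (cell Lx Ly) :=
    fun α β γ => ((i2.const_mul α).sub (i1.const_mul β)).add (integrable_const γ)
  have hquad : ∀ α β γ : ℝ, ∫ x in cell Lx Ly, (α * f x ^ 2 - β * f x + γ) =
      α * S - β * m + Lx * Ly * γ := by
    intro α β γ
    have i3 : IntegrableOn (fun x => α * f x ^ 2) (cell Lx Ly) := i2.const_mul α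
    have i4 : IntegrableOn (fun x => β * f x) (cell Lx Ly) := i1.const_mul β
    have i5 : IntegrableOn (fun x => α * f x ^ 2 - β * f x) (cell Lx Ly) := i3.sub i4
    rw [integral_add i5 (integrable_const _), integral_sub i3 i4, integral_const_mul,
      integral_const_mul, integral_const, measureReal_restrict_apply_univ,
      volume_real_cell hLx hLy, smul_eq_mul]
  have hexp : ∀ a b, (f a - f b) ^ 2 = 1 * f b ^ 2 - 2 * f a * f b + f a ^ 2 := by
    intro a b; ring
  have hinner : ∀ a, ∫ b in cell Lx Ly, (f a - f b) ^ 2 =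
      Lx * Ly * f a ^ 2 - 2 * m * f a + S := by
    intro a
    simp_rw [hexp]
    rw [hquad]; ring
  have hnn : ∀ a, 0 ≤ Lx * Ly * f a ^ 2 - 2 * m * f a + S := fun a =>
    hinner a ▸ integral_nonneg fun b => sq_nonneg _
  have hlin : ∀ a, ∫⁻ b in cell Lx Ly, ENNReal.ofReal ((f a - f b) ^ 2) =
      ENNReal.ofReal (Lx * Ly * f a ^ 2 - 2 * m * f a + S) := by
    intro a
    rw [← hinner, ofReal_integral_eq_lintegral_ofReal _ (ae_of_all _ fun b => sq_nonneg _)]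
    simp_rw [hexp]
    exact hint _ _ _
  simp_rw [hlin] at key
  rw [← ofReal_integral_eq_lintegral_ofReal (hint _ _ _) (ae_of_all _ hnn), hquad,
    hq, hq, hq, ← ENNReal.ofReal_mul (by positivity), ← ENNReal.ofReal_mul (by positivity),
    ← ENNReal.ofReal_mul (by positivity), ← ENNReal.ofReal_add
      (mul_nonneg (by positivity) (nq 1)) (mul_nonneg (by positivity) (nq 2)),
    ← ENNReal.ofReal_add (mul_nonneg (by positivity) (nq 0)) (add_nonneg
      (mul_nonneg (by positivity) (nq 1)) (mul_nonneg (by positivity) (nq 2))),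
    ENNReal.ofReal_le_ofReal_iff (add_nonneg (mul_nonneg (by positivity) (nq 0)) (add_nonneg
      (mul_nonneg (by positivity) (nq 1)) (mul_nonneg (by positivity) (nq 2))))] at key
  rw [integral_finsetSum _ fun i _ => iq i, Fin.sum_univ_three, div_mul_eq_mul_div,
    le_div_iff₀ (by positivity)]
  have p0 := nq 0
  have p1 := nq 1
  have p2 := nq 2
  set A := ∫ x in cell Lx Ly, pd 0 f x ^ 2
  set B := ∫ x in cell Lx Ly, pd 1 f x ^ 2
  set C := ∫ x in cell Lx Ly, pd 2 f x ^ 2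
  have c0 : 0 ≤ 2 * Ly * Lx ^ 3 := by positivity
  have c1 : 0 ≤ 4 * Lx * Ly ^ 3 := by positivity
  have c2 : 0 ≤ 4 * Lx * Ly := by positivity
  generalize 2 * Ly * Lx ^ 3 = k0 at *
  generalize 4 * Lx * Ly ^ 3 = k1 at *
  generalize 4 * Lx * Ly = k2 at *
  nlinarith [mul_nonneg c0 p1, mul_nonneg c0 p2, mul_nonneg c1 p0, mul_nonneg c1 p2,
    mul_nonneg c2 p0, mul_nonneg c2 p1, mul_nonneg c0 (sq_nonneg m), mul_nonneg c1 (sq_nonneg m),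
    mul_nonneg c2 (sq_nonneg m), mul_nonneg c0 p0, mul_nonneg c1 p1, mul_nonneg c2 p2, sq_nonneg m]

/-! ### Evolution of integrals -/

theorem isOpen_times (tmax : EReal) : IsOpen (times tmax) :=
  isOpen_Ioi.inter (isOpen_Iio.preimage continuous_coe_real_ereal)

theorem Icc_subset_times {tmax : EReal} {s t : ℝ} (hs : 0 < s) (ht : (t : EReal) < tmax) :
    Set.Icc s t ⊆ times tmax := fun _ hr =>
  ⟨hs.trans_le hr.1, lt_of_le_of_lt (EReal.coe_le_coe_iff.2 hr.2) ht⟩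

theorem hasDerivAt_integral_cell {S : Set ℝ} (hS : IsOpen S) {G G' : ℝ → Pt → ℝ}
    (hG : ContinuousOn (fun q : ℝ × Pt => G q.1 q.2) (S ×ˢ slab))
    (hG' : ContinuousOn (fun q : ℝ × Pt => G' q.1 q.2) (S ×ˢ slab))
    (hd : ∀ t ∈ S, ∀ x ∈ slab, HasDerivAt (fun s => G s x) (G' t x) t) (Lx Ly : ℝ)
    {t : ℝ} (ht : t ∈ S) :
    HasDerivAt (fun s => ∫ x in cell Lx Ly, G s x) (∫ x in cell Lx Ly, G' t x) t := by
  have slice : ∀ {H : ℝ → Pt → ℝ},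
      ContinuousOn (fun q : ℝ × Pt => H q.1 q.2) (S ×ˢ slab) → ∀ s ∈ S, ContinuousOn (H s) slab :=
    fun {H} hH s hs => hH.comp (f := fun x : Pt => (s, x)) (by fun_prop) fun x hx => ⟨hs, hx⟩
  obtain ⟨ε, hε, hball⟩ := Metric.nhds_basis_closedBall.mem_iff.1 (hS.mem_nhds ht)
  have hK : IsCompact (Metric.closedBall t ε ×ˢ cell Lx Ly) :=
    (isCompact_closedBall t ε).prod (isCompact_cell Lx Ly)
  obtain ⟨M, hM⟩ := hK.exists_bound_of_continuousOn
    (hG'.mono (Set.prod_mono hball (cell_subset_slab Lx Ly)))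
  have hcell := isFiniteMeasure_cell Lx Ly
  refine (hasDerivAt_integral_of_dominated_loc_of_deriv_le (bound := fun _ => M) (F' := G')
    (Metric.closedBall_mem_nhds t hε) ?_ ?_ ?_ ?_ (integrable_const M) ?_).2
  · filter_upwards [hS.mem_nhds ht] with s hs
    exact (integrableOn_cell (slice hG s hs) Lx Ly).aestronglyMeasurable
  · exact integrableOn_cell (slice hG t ht) Lx Ly
  · exact (integrableOn_cell (slice hG' t ht) Lx Ly).aestronglyMeasurable
  · filter_upwards [ae_restrict_mem (measurableSet_cell Lx Ly)] with x hx s hs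
    exact hM (s, x) ⟨hs, hx⟩
  · filter_upwards [ae_restrict_mem (measurableSet_cell Lx Ly)] with x hx s hs
    exact hd s (hball hs) x (cell_subset_slab Lx Ly hx)

theorem le_of_hasDerivAt_nonpos {y y' : ℝ → ℝ} {s t : ℝ} (hst : s ≤ t)
    (hd : ∀ r ∈ Set.Icc s t, HasDerivAt y (y' r) r) (hle : ∀ r ∈ Set.Icc s t, y' r ≤ 0) :
    y t ≤ y s := by
  refine antitoneOn_of_deriv_nonpos (convex_Icc s t)
    (fun r hr => (hd r hr).continuousAt.continuousWithinAt)
    (fun r hr => (hd r (interior_subset hr)).differentiableAt.differentiableWithinAt)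
    (fun r hr => ?_) (Set.left_mem_Icc.2 hst) (Set.right_mem_Icc.2 hst) hst
  rw [(hd r (interior_subset hr)).deriv]
  exact hle r (interior_subset hr)

theorem le_add_div_of_hasDerivAt_le {y y' : ℝ → ℝ} {s t κ B : ℝ} (hκ : 0 < κ) (hB : 0 ≤ B)
    (hst : s ≤ t) (hd : ∀ r ∈ Set.Icc s t, HasDerivAt y (y' r) r)
    (hle : ∀ r ∈ Set.Icc s t, y' r ≤ -κ * y r + B) (hy : 0 ≤ y s) : y t ≤ y s + B / κ := by
  have hexp : ∀ r, HasDerivAt (fun r => Real.exp (κ * r)) (Real.exp (κ * r) * κ) r := fun r => by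
    simpa using ((hasDerivAt_id r).const_mul κ).exp
  have key := le_of_hasDerivAt_nonpos hst (y := fun r => (y r - B / κ) * Real.exp (κ * r))
    (y' := fun r => y' r * Real.exp (κ * r) + (y r - B / κ) * (Real.exp (κ * r) * κ))
    (fun r hr => ((hd r hr).sub_const _).mul (hexp r)) (fun r hr => by
      have h1 := hle r hr
      have h2 : y' r * Real.exp (κ * r) + (y r - B / κ) * (Real.exp (κ * r) * κ) =
          (y' r + κ * y r - B) * Real.exp (κ * r) := by field_simp; ring
      rw [h2]
      exact mul_nonpos_of_nonpos_of_nonneg (by linarith) (Real.exp_pos _).le)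
  have h3 : (y s - B / κ) * Real.exp (κ * s) ≤ y s * Real.exp (κ * t) := by
    have h4 : Real.exp (κ * s) ≤ Real.exp (κ * t) :=
      Real.exp_le_exp.2 (mul_le_mul_of_nonneg_left hst hκ.le)
    have h5 : 0 ≤ B / κ := by positivity
    nlinarith [Real.exp_pos (κ * s), mul_nonneg h5 (Real.exp_pos (κ * s)).le]
  have := le_of_mul_le_mul_right (key.trans h3) (Real.exp_pos _)
  linarith

/-! ### A convex truncation of the square -/

/-- The distance from `s` to `[-M, M]`, with the sign of `s`. -/
noncomputable def shrink (M s : ℝ) : ℝ := s - max (-M) (min M s)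

theorem shrink_of_abs_le {M s : ℝ} (h : |s| ≤ M) : shrink M s = 0 := by
  rw [abs_le] at h
  rw [shrink, min_eq_right h.2, max_eq_right h.1, sub_self]

theorem shrink_of_ge {M s : ℝ} (hM : 0 ≤ M) (h : M ≤ s) : shrink M s = s - M := by
  rw [shrink, min_eq_left h, max_eq_right (by linarith)]

theorem shrink_of_le {M s : ℝ} (hM : 0 ≤ M) (h : s ≤ -M) : shrink M s = s + M := by
  rw [shrink, min_eq_right (by linarith), max_eq_left h, sub_neg_eq_add]

theorem shrink_zero {M : ℝ} (hM : 0 ≤ M) : shrink M 0 = 0 :=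
  shrink_of_abs_le (by simpa using hM)

theorem continuous_shrink (M : ℝ) : Continuous (shrink M) := by
  unfold shrink; fun_prop

theorem abs_shrink_sub_le {M : ℝ} (hM : 0 ≤ M) (s t : ℝ) :
    |shrink M s - shrink M t| ≤ |s - t| := by
  wlog h : t ≤ s generalizing s t
  · rw [abs_sub_comm, abs_sub_comm s]; exact this t s (le_of_not_ge h)
  unfold shrink
  rw [abs_of_nonneg (sub_nonneg.2 h), abs_le]
  rcases le_total M s with h1 | h1 <;> rcases le_total M t with h2 | h2 <;>
    rcases le_total (-M) s with h3 | h3 <;> rcases le_total (-M) t with h4 | h4 <;>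
    simp only [min_eq_left, min_eq_right, max_eq_left, max_eq_right, h1, h2, h3, h4,
      neg_le_self hM] <;> constructor <;> linarith

theorem hasDerivAt_comp_shrink {M : ℝ} (hM : 0 ≤ M) {φ φ' : ℝ → ℝ}
    (hφ : ∀ r, HasDerivAt φ (φ' r) r) (h0 : φ' 0 = 0) (s : ℝ) :
    HasDerivAt (fun r => φ (shrink M r)) (φ' (shrink M s)) s := by
  rcases lt_or_ge M s with h | h
  · rw [shrink_of_ge hM h.le]
    refine ((hφ (s - M)).comp_sub_const s M).congr_of_eventuallyEq ?_
    filter_upwards [Ioi_mem_nhds h] with r hr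
    rw [shrink_of_ge hM (le_of_lt hr)]
  rcases lt_or_ge s (-M) with h' | h'
  · rw [shrink_of_le hM h'.le]
    refine ((hφ (s + M)).comp_add_const s M).congr_of_eventuallyEq ?_
    filter_upwards [Iio_mem_nhds h'] with r hr
    rw [shrink_of_le hM (le_of_lt hr)]
  have hs : shrink M s = 0 := shrink_of_abs_le (abs_le.2 ⟨h', h⟩)
  have h1 := hφ (shrink M s)
  have hz : φ' (shrink M s) = 0 := by rw [hs, h0]
  rw [hasDerivAt_iff_isLittleO, hz] at h1 ⊢
  have h2 := h1.comp_tendsto (k := shrink M) (continuous_shrink M).continuousAt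
  simp only [smul_zero, sub_zero] at h2 ⊢
  exact h2.trans_isBigO (Asymptotics.IsBigO.of_bound (g := fun r => r - s) 1 (.of_forall fun r => by
    simpa using abs_shrink_sub_le hM r s))

/-- A function of class `C²` that vanishes to third order at `0` and grows like the square. -/
noncomputable def flatSq (r : ℝ) : ℝ := r ^ 4 / (1 + r ^ 2)

/-- The derivative of `flatSq`. -/
noncomputable def flatSqDeriv (r : ℝ) : ℝ := 2 * r ^ 3 * (2 + r ^ 2) / (1 + r ^ 2) ^ 2

/-- The second derivative of `flatSq`. -/
noncomputable def flatSqDeriv₂ (r : ℝ) : ℝ :=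
  (2 * r ^ 2 * (r ^ 4 + 3 * r ^ 2 + 6)) / (1 + r ^ 2) ^ 3

theorem hasDerivAt_flatSq (r : ℝ) : HasDerivAt flatSq (flatSqDeriv r) r := by
  have h : (1 + r ^ 2) ≠ 0 := by positivity
  refine ((hasDerivAt_pow 4 r).div ((hasDerivAt_pow 2 r).const_add 1) h).congr_deriv ?_
  rw [flatSqDeriv]; field_simp; push_cast; ring

theorem hasDerivAt_flatSqDeriv (r : ℝ) : HasDerivAt flatSqDeriv (flatSqDeriv₂ r) r := by
  have h : (1 + r ^ 2) ^ 2 ≠ 0 := by positivity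
  refine ((((hasDerivAt_pow 3 r).const_mul 2).mul ((hasDerivAt_pow 2 r).const_add 2)).div
    (((hasDerivAt_pow 2 r).const_add 1).pow 2) h).congr_deriv ?_
  have h : (1 + r ^ 2) ≠ 0 := by positivity
  simp only [Pi.pow_apply, Pi.mul_apply]
  rw [flatSqDeriv₂]; field_simp; push_cast; ring

theorem flatSqDeriv₂_nonneg (r : ℝ) : 0 ≤ flatSqDeriv₂ r := by
  unfold flatSqDeriv₂; positivity

theorem continuous_flatSqDeriv₂ : Continuous flatSqDeriv₂ := by
  unfold flatSqDeriv₂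
  exact Continuous.div (by fun_prop) (by fun_prop) fun r => by positivity

theorem flatSqDeriv_nonneg {r : ℝ} (h : 0 ≤ r) : 0 ≤ flatSqDeriv r := by
  unfold flatSqDeriv; positivity

theorem flatSqDeriv_neg (r : ℝ) : flatSqDeriv (-r) = -flatSqDeriv r := by
  unfold flatSqDeriv; ring

theorem flatSq_le_sq (r : ℝ) : flatSq r ≤ r ^ 2 := by
  rw [flatSq, div_le_iff₀ (by positivity)]
  nlinarith [sq_nonneg r]

theorem sq_le_flatSq_add (r : ℝ) : r ^ 2 ≤ flatSq r + 1 := by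
  rw [flatSq, ← sub_le_iff_le_add, le_div_iff₀ (by positivity)]
  nlinarith [sq_nonneg r]

theorem sq_le_flatSq_shrink {M : ℝ} (hM : 0 ≤ M) (s : ℝ) :
    s ^ 2 ≤ 2 * flatSq (shrink M s) + 2 * (M ^ 2 + 1) := by
  have h1 := sq_le_flatSq_add (shrink M s)
  have h2 : |s - shrink M s| ≤ M := by
    rw [shrink, sub_sub_cancel, abs_le]
    exact ⟨le_max_left _ _, max_le (by linarith) (min_le_left _ _)⟩
  have h3 : (s - shrink M s) ^ 2 ≤ M ^ 2 := sq_le_sq.2 (by rwa [abs_of_nonneg hM])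
  nlinarith [sq_nonneg (s - 2 * shrink M s)]

theorem flatSq_shrink_le {M : ℝ} (hM : 0 ≤ M) (s : ℝ) : flatSq (shrink M s) ≤ s ^ 2 := by
  refine (flatSq_le_sq _).trans (sq_le_sq.2 ?_)
  simpa [shrink_zero hM] using abs_shrink_sub_le hM s 0

/-! ### The temperature -/

section Solution

variable {Pr R Lx Ly : ℝ} {η : ℝ≥0∞} {tmax : EReal} {u : ℝ → Pt → Vel} {p T : ℝ → Pt → ℝ}

theorem continuousOn_slice {S : Set ℝ} {F : Type*} [TopologicalSpace F] {H : ℝ → Pt → F}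
    (hH : ContinuousOn (fun q : ℝ × Pt => H q.1 q.2) (S ×ˢ slab)) {s : ℝ} (hs : s ∈ S) :
    ContinuousOn (H s) slab :=
  hH.comp (f := fun x : Pt => (s, x)) (by fun_prop) fun _ hx => ⟨hs, hx⟩

namespace IsSolution

theorem contDiffOn_u (h : IsSolution Pr R Lx Ly η tmax u p T) {t : ℝ} (ht : t ∈ times tmax)
    (i : Fin 3) : ContDiffOn ℝ 2 (fun x => u t x i) slab :=
  contDiffOn_euclidean.1 (h.u_contDiff t ht) i

theorem contDiffOn_u_one (h : IsSolution Pr R Lx Ly η tmax u p T) {t : ℝ} (ht : t ∈ times tmax)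
    (i : Fin 3) : ContDiffOn ℝ 1 (fun x => u t x i) slab :=
  (h.contDiffOn_u ht i).of_le (by norm_num)

theorem contDiffOn_T_one (h : IsSolution Pr R Lx Ly η tmax u p T) {t : ℝ} (ht : t ∈ times tmax) :
    ContDiffOn ℝ 1 (T t) slab :=
  (h.T_contDiff t ht).of_le (by norm_num)

theorem continuousOn_Tt (h : IsSolution Pr R Lx Ly η tmax u p T) {t : ℝ} (ht : t ∈ times tmax) :
    ContinuousOn (fun x => deriv (fun s => T s x) t) slab :=
  continuousOn_slice (H := fun t x => deriv (fun s => T s x) t) h.Tt_continuous ht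

/-- The balance of `∫ F(T)`, where `F' = g`, for boundary data of favourable sign. -/
theorem integral_heat_le (h : IsSolution Pr R Lx Ly η tmax u p T) (hLx : 0 < Lx) (hLy : 0 < Ly)
    {F g g' : ℝ → ℝ} (hF : ∀ s, HasDerivAt F (g s) s) (hg : ∀ s, HasDerivAt g (g' s) s)
    (hg' : Continuous g') (c : ℝ) {t : ℝ} (ht : t ∈ times tmax)
    (hbot : ∀ x : Pt, x 2 = 0 → 0 ≤ g (T t x) * (pd 2 (T t) x + c))
    (htop : ∀ x : Pt, x 2 = 1 → g (T t x) * (pd 2 (T t) x + c) ≤ 0) :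
    ∫ x in cell Lx Ly, g (T t x) * deriv (fun s => T s x) t ≤
      -∫ x in cell Lx Ly, g' (T t x) * (∑ j, pd j (T t) x ^ 2 + c * pd 2 (T t) x) := by
  have hT := h.contDiffOn_T_one ht
  have cg : Continuous g := continuous_iff_continuousAt.2 fun s => (hg s).continuousAt
  have dg : ContDiff ℝ 1 g := by
    rw [contDiff_one_iff_deriv]
    exact ⟨fun s => (hg s).differentiableAt, by rwa [funext fun s => (hg s).deriv]⟩
  have dF : ContDiff ℝ 1 F := by
    rw [contDiff_one_iff_deriv]
    exact ⟨fun s => (hF s).differentiableAt, by rwa [funext fun s => (hF s).deriv]⟩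
  set d : Fin 3 → ℝ := fun j => if j = 2 then c else 0 with hd
  have hq : ∀ j, ContDiffOn ℝ 1 (fun x => pd j (T t) x + d j) slab := fun j =>
    (contDiffOn_pd (h.T_contDiff t ht) j).add contDiffOn_const
  have hgT := contDiffOn_comp dg hT
  have hFT := contDiffOn_comp dF hT
  have hdiv := integral_div_nonpos hLx hLy
    (V := fun j x => g (T t x) * (pd j (T t) x + d j) - F (T t x) * u t x j)
    (fun j => (hgT.mul (hq j)).sub (hFT.mul (h.contDiffOn_u_one ht j)))
    (fun j => (((h.T_periodic t ht).comp g).comp₂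
        (((h.T_periodic t ht).pd j).comp fun r => r + d j) fun a b => a * b).comp₂
      (((h.T_periodic t ht).comp F).comp₂ ((h.u_periodic t ht).comp fun v => v j)
        fun a b => a * b) fun a b => a - b)
    (fun x hx => by
      have h0 : u t x 2 = 0 := by rw [h.no_slip t ht x (.inl hx)]; rfl
      simpa [h0, hd] using hbot x hx)
    (fun x hx => by
      have h0 : u t x 2 = 0 := by rw [h.no_slip t ht x (.inr hx)]; rfl
      simpa [h0, hd] using htop x hx)
  rw [setIntegral_cell_congr (g := fun x => g (T t x) * deriv (fun s => T s x) t +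
    g' (T t x) * (∑ j, pd j (T t) x ^ 2 + c * pd 2 (T t) x)) Lx Ly] at hdiv
  · have cT := hT.continuousOn
    have i1 : IntegrableOn (fun x => g (T t x) * deriv (fun s => T s x) t) (cell Lx Ly) :=
      integrableOn_cell ((cg.comp_continuousOn cT).mul (h.continuousOn_Tt ht)) Lx Ly
    have i2 : IntegrableOn (fun x => g' (T t x) * (∑ j, pd j (T t) x ^ 2 + c * pd 2 (T t) x))
        (cell Lx Ly) :=
      integrableOn_cell ((hg'.comp_continuousOn cT).mul
        ((continuousOn_finsetSum _ fun j _ => (continuousOn_pd hT j).pow 2).add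
          (continuousOn_const.mul (continuousOn_pd hT 2)))) Lx Ly
    rw [integral_add i1 i2] at hdiv
    linarith
  · intro x h0 h1
    have hx : x ∈ slab := ⟨h0.le, h1.le⟩
    have hheat := h.heat t ht x h0 h1
    have hinc := h.incompressible t ht x h0 h1
    have e : ∀ j, pd j (fun x => g (T t x) * (pd j (T t) x + d j) - F (T t x) * u t x j) x =
        g (T t x) * pd j (pd j (T t)) x + (pd j (T t) x + d j) * (g' (T t x) * pd j (T t) x) -
        (F (T t x) * pd j (fun y => u t y j) x + u t x j * (g (T t x) * pd j (T t) x)) := by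
      intro j
      rw [pd_sub (hgT.mul (hq j)) (hFT.mul (h.contDiffOn_u_one ht j)) hx,
        pd_mul hgT (hq j) hx, pd_mul hFT (h.contDiffOn_u_one ht j) hx, pd_comp (hg _) hT hx,
        pd_comp (hF _) hT hx, pd_add (contDiffOn_pd (h.T_contDiff t ht) j) contDiffOn_const hx,
        pd_const _ hx, add_zero]
    simp only [e]
    rw [lap] at hheat
    simp only [Fin.sum_univ_three, hd] at hheat hinc ⊢
    simp only [Fin.isValue, Fin.reduceEq, if_false, if_true]
    linear_combination g (T t x) * (-hheat) - F (T t x) * hinc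

theorem hasDerivAt_integral_comp_T (h : IsSolution Pr R Lx Ly η tmax u p T)
    {F g : ℝ → ℝ} (hF : ∀ s, HasDerivAt F (g s) s) (cg : Continuous g) {t : ℝ}
    (ht : t ∈ times tmax) :
    HasDerivAt (fun s => ∫ x in cell Lx Ly, F (T s x))
      (∫ x in cell Lx Ly, g (T t x) * deriv (fun s => T s x) t) t := by
  have cF : Continuous F := continuous_iff_continuousAt.2 fun s => (hF s).continuousAt
  refine hasDerivAt_integral_cell (isOpen_times tmax)
    (G' := fun t x => g (T t x) * deriv (fun s => T s x) t)
    (cF.comp_continuousOn h.T_continuous)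
    ((cg.comp_continuousOn h.T_continuous).mul h.Tt_continuous) (fun s hs x hx => ?_) Lx Ly ht
  exact (hF (T s x)).comp s (h.T_differentiable s hs x hx).hasDerivAt

theorem integral_sq_T_le_of_ne_top (h : IsSolution Pr R Lx Ly η tmax u p T) (hLx : 0 < Lx)
    (hLy : 0 < Ly) (hη : η ≠ ⊤) {s t : ℝ} (hs : 0 < s) (hst : s ≤ t) (ht : (t : EReal) < tmax) :
    ∫ x in cell Lx Ly, T t x ^ 2 ≤
      2 * ((1 + η.toReal) ^ 2 + 1) * (Lx * Ly) + 2 * ∫ x in cell Lx Ly, T s x ^ 2 := by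
  set e := η.toReal with he
  have he0 : 0 ≤ e := ENNReal.toReal_nonneg
  have hM : 0 ≤ 1 + e := by linarith
  have hsub := Icc_subset_times hs ht
  have hF := hasDerivAt_comp_shrink hM hasDerivAt_flatSq (by simp [flatSqDeriv])
  have hg := hasDerivAt_comp_shrink hM hasDerivAt_flatSqDeriv (by simp [flatSqDeriv₂])
  have hg' : Continuous fun r => flatSqDeriv₂ (shrink (1 + e) r) :=
    continuous_flatSqDeriv₂.comp (continuous_shrink _)
  have cg : Continuous fun r => flatSqDeriv (shrink (1 + e) r) :=
    continuous_iff_continuousAt.2 fun s => (hg s).continuousAt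
  have g0 : ∀ r, |r| ≤ 1 + e → flatSqDeriv (shrink (1 + e) r) = 0 := fun r hr => by
    rw [shrink_of_abs_le hr]; simp [flatSqDeriv]
  have g1 : ∀ r, 1 + e ≤ r → 0 ≤ flatSqDeriv (shrink (1 + e) r) := fun r hr => by
    rw [shrink_of_ge hM hr]; exact flatSqDeriv_nonneg (by linarith)
  have g2 : ∀ r, r ≤ -(1 + e) → flatSqDeriv (shrink (1 + e) r) ≤ 0 := fun r hr => by
    rw [shrink_of_le hM hr, ← neg_nonneg, ← flatSqDeriv_neg]
    exact flatSqDeriv_nonneg (by linarith)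
  have hmono : ∫ x in cell Lx Ly, flatSq (shrink (1 + e) (T t x)) ≤
      ∫ x in cell Lx Ly, flatSq (shrink (1 + e) (T s x)) := by
    refine le_of_hasDerivAt_nonpos
      (y := fun r => ∫ x in cell Lx Ly, flatSq (shrink (1 + e) (T r x))) hst
      (fun r hr => h.hasDerivAt_integral_comp_T hF cg (hsub hr)) fun r hr => ?_
    obtain ⟨hb, htp⟩ := (h.thermal r (hsub hr)).1 hη
    refine (h.integral_heat_le hLx hLy hF hg hg' 0 (hsub hr) ?_ ?_).trans
      (neg_nonpos.2 (integral_nonneg fun x => mul_nonneg (flatSqDeriv₂_nonneg _) ?_))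
    · intro x hx
      have := hb x hx
      rw [add_zero]
      rcases le_or_gt |T r x| (1 + e) with h1 | h1
      · rw [g0 _ h1, zero_mul]
      rcases lt_abs.1 h1 with h1 | h1
      · refine mul_nonneg (g1 _ h1.le) ?_
        by_contra! hneg
        nlinarith
      · refine mul_nonneg_of_nonpos_of_nonpos (g2 _ (by linarith)) ?_
        by_contra! hpos
        nlinarith
    · intro x hx
      have := htp x hx
      rw [add_zero]
      rcases le_or_gt |T r x| (1 + e) with h1 | h1
      · rw [g0 _ h1, zero_mul]
      rcases lt_abs.1 h1 with h1 | h1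
      · refine mul_nonpos_of_nonneg_of_nonpos (g1 _ h1.le) ?_
        by_contra! hpos
        nlinarith
      · refine mul_nonpos_of_nonpos_of_nonneg (g2 _ (by linarith)) ?_
        by_contra! hneg
        nlinarith
    · rw [zero_mul, add_zero]
      exact Finset.sum_nonneg fun j _ => sq_nonneg _
  have hcF : Continuous fun r => flatSq (shrink (1 + e) r) :=
    continuous_iff_continuousAt.2 fun s => (hF s).continuousAt
  have hsm := hsub (Set.left_mem_Icc.2 hst)
  have htm := hsub (Set.right_mem_Icc.2 hst)
  have iF : ∀ r ∈ times tmax, IntegrableOn (fun x => flatSq (shrink (1 + e) (T r x)))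
      (cell Lx Ly) := fun r hr =>
    integrableOn_cell (hcF.comp_continuousOn (h.contDiffOn_T_one hr).continuousOn) Lx Ly
  have iT : ∀ r ∈ times tmax, IntegrableOn (fun x => T r x ^ 2) (cell Lx Ly) := fun r hr =>
    integrableOn_cell ((h.contDiffOn_T_one hr).continuousOn.pow 2) Lx Ly
  have hcell := isFiniteMeasure_cell Lx Ly
  have a1 : ∫ x in cell Lx Ly, T t x ^ 2 ≤ ∫ x in cell Lx Ly,
      (2 * flatSq (shrink (1 + e) (T t x)) + 2 * ((1 + e) ^ 2 + 1)) :=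
    integral_mono (iT t htm) (((iF t htm).const_mul 2).add (integrable_const _))
      fun x => sq_le_flatSq_shrink hM _
  rw [integral_add ((iF t htm).const_mul 2) (integrable_const _), integral_const_mul,
    integral_const, measureReal_restrict_apply_univ, volume_real_cell hLx hLy, smul_eq_mul] at a1
  have a2 : ∫ x in cell Lx Ly, flatSq (shrink (1 + e) (T s x)) ≤ ∫ x in cell Lx Ly, T s x ^ 2 :=
    integral_mono (iF s hsm) (iT s hsm) fun x => flatSq_shrink_le hM _
  linarith

end IsSolution

end Solution

theorem sq_integral_cell_le {Lx Ly : ℝ} (hLx : 0 < Lx) (hLy : 0 < Ly) {f : Pt → ℝ}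
    (hf : ContinuousOn f slab) :
    (∫ x in cell Lx Ly, f x) ^ 2 ≤ Lx * Ly * ∫ x in cell Lx Ly, f x ^ 2 := by
  have hcell := isFiniteMeasure_cell Lx Ly
  have i1 : IntegrableOn f (cell Lx Ly) := integrableOn_cell hf Lx Ly
  have i2 : IntegrableOn (fun x => f x ^ 2) (cell Lx Ly) := integrableOn_cell (hf.pow 2) Lx Ly
  set m := ∫ x in cell Lx Ly, f x with hm
  have hV : 0 < Lx * Ly := mul_pos hLx hLy
  have h0 : 0 ≤ ∫ x in cell Lx Ly, (f x ^ 2 - 2 * (m / (Lx * Ly)) * f x + (m / (Lx * Ly)) ^ 2) :=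
    integral_nonneg fun x => by
      have := sq_nonneg (f x - m / (Lx * Ly))
      simp only [Pi.zero_apply]
      linarith
  have i3 : IntegrableOn (fun x => 2 * (m / (Lx * Ly)) * f x) (cell Lx Ly) := i1.const_mul _
  have i4 : IntegrableOn (fun x => f x ^ 2 - 2 * (m / (Lx * Ly)) * f x) (cell Lx Ly) := i2.sub i3
  rw [integral_add i4 (integrable_const _), integral_sub i2 i3, integral_const_mul, ← hm,
    integral_const, measureReal_restrict_apply_univ, volume_real_cell hLx hLy, smul_eq_mul] at h0
  have h1 : Lx * Ly * (m / (Lx * Ly)) ^ 2 = m ^ 2 / (Lx * Ly) := by field_simp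
  have h2 : 2 * (m / (Lx * Ly)) * m = 2 * (m ^ 2 / (Lx * Ly)) := by ring
  rw [h1, h2] at h0
  rw [← div_le_iff₀' hV]
  linarith

section Solution

variable {Pr R Lx Ly : ℝ} {η : ℝ≥0∞} {tmax : EReal} {u : ℝ → Pt → Vel} {p T : ℝ → Pt → ℝ}

namespace IsSolution

theorem integral_T_eq (h : IsSolution Pr R Lx Ly ⊤ tmax u p T) (hLx : 0 < Lx) (hLy : 0 < Ly)
    {s t : ℝ} (hs : 0 < s) (hst : s ≤ t) (ht : (t : EReal) < tmax) :
    ∫ x in cell Lx Ly, T t x = ∫ x in cell Lx Ly, T s x := by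
  have hsub := Icc_subset_times hs ht
  have hwall : ∀ r ∈ times tmax, ∀ x : Pt, x 2 = 0 ∨ x 2 = 1 → pd 2 (T r) x + 1 = 0 :=
    fun r hr x hx => by rw [(h.thermal r hr).2 rfl x hx]; norm_num
  have key : ∀ c : ℝ, ∫ x in cell Lx Ly, c * T t x ≤ ∫ x in cell Lx Ly, c * T s x := by
    intro c
    have hF : ∀ r : ℝ, HasDerivAt (fun r => c * r) ((fun _ => c) r) r := fun r => by
      simpa using (hasDerivAt_id r).const_mul c
    refine le_of_hasDerivAt_nonpos (y := fun r => ∫ x in cell Lx Ly, c * T r x) hst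
      (fun r hr => h.hasDerivAt_integral_comp_T hF continuous_const (hsub hr)) fun r hr => ?_
    have := h.integral_heat_le hLx hLy hF (fun r => hasDerivAt_const r c) continuous_const 1
      (hsub hr) (fun x hx => by rw [hwall r (hsub hr) x (.inl hx), mul_zero])
      (fun x hx => by rw [hwall r (hsub hr) x (.inr hx), mul_zero])
    simpa using this
  have h1 := key 1
  have h2 := key (-1)
  simp only [one_mul, neg_mul, integral_neg] at h1 h2
  linarith

theorem exists_integral_sq_T_le_of_top (hLx : 0 < Lx) (hLy : 0 < Ly) :
    ∃ A, 0 ≤ A ∧ ∀ {tmax : EReal} {u : ℝ → Pt → Vel} {p T : ℝ → Pt → ℝ},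
      IsSolution Pr R Lx Ly ⊤ tmax u p T → ∀ {s t : ℝ}, 0 < s → s ≤ t → (t : EReal) < tmax →
      ∫ x in cell Lx Ly, T t x ^ 2 ≤ A * (1 + ∫ x in cell Lx Ly, T s x ^ 2) := by
  obtain ⟨K, hK, hP⟩ := integral_sq_le_of_integral hLx hLy
  refine ⟨1 + K * (Lx * Ly), by positivity, fun {tmax u p T} h {s t} hs hst ht => ?_⟩
  have hcell := isFiniteMeasure_cell Lx Ly
  have hsub := Icc_subset_times hs ht
  have hwall : ∀ r ∈ times tmax, ∀ x : Pt, x 2 = 0 ∨ x 2 = 1 → pd 2 (T r) x + 1 = 0 :=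
    fun r hr x hx => by rw [(h.thermal r hr).2 rfl x hx]; norm_num
  set Y := ∫ x in cell Lx Ly, T s x ^ 2 with hY
  have hY0 : 0 ≤ Y := integral_nonneg fun x => sq_nonneg _
  have hF : ∀ r : ℝ, HasDerivAt (fun r : ℝ => r ^ 2) ((fun r => 2 * r) r) r := fun r => by
    simpa using hasDerivAt_pow 2 r
  have hg : ∀ r : ℝ, HasDerivAt (fun r : ℝ => 2 * r) ((fun _ => 2) r) r := fun r => by
    simpa using (hasDerivAt_id r).const_mul 2
  have := le_add_div_of_hasDerivAt_le (y := fun r => ∫ x in cell Lx Ly, T r x ^ 2)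
    (κ := K⁻¹) (B := Lx * Ly * Y + Lx * Ly) (inv_pos.2 hK) (by positivity) hst
    (fun r hr => h.hasDerivAt_integral_comp_T hF (by fun_prop) (hsub hr)) (fun r hr => ?_) hY0
  · rw [div_inv_eq_mul] at this
    linarith
  have hT := h.contDiffOn_T_one (hsub hr)
  have b1 := h.integral_heat_le hLx hLy hF hg continuous_const 1
      (hsub hr) (fun x hx => by rw [hwall r (hsub hr) x (.inl hx), mul_zero])
      (fun x hx => by rw [hwall r (hsub hr) x (.inr hx), mul_zero])
  have cD : ContinuousOn (fun x => ∑ j, pd j (T r) x ^ 2) slab :=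
    continuousOn_finsetSum _ fun j _ => (continuousOn_pd hT j).pow 2
  have iD : IntegrableOn (fun x => ∑ j, pd j (T r) x ^ 2) (cell Lx Ly) :=
    integrableOn_cell cD Lx Ly
  have b2 : ∫ x in cell Lx Ly, (∑ j, pd j (T r) x ^ 2 - 1) ≤
      ∫ x in cell Lx Ly, 2 * (∑ j, pd j (T r) x ^ 2 + 1 * pd 2 (T r) x) := by
    refine integral_mono (iD.sub (integrable_const _)) (integrableOn_cell (continuousOn_const.mul
      (cD.add (continuousOn_const.mul (continuousOn_pd hT 2)))) Lx Ly) fun x => ?_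
    simp only [Fin.sum_univ_three]
    nlinarith [sq_nonneg (pd 0 (T r) x), sq_nonneg (pd 1 (T r) x), sq_nonneg (pd 2 (T r) x + 1)]
  rw [integral_sub iD (integrable_const _), integral_const, measureReal_restrict_apply_univ,
    volume_real_cell hLx hLy, smul_eq_mul, mul_one] at b2
  have b3 := hP (T r) hT
  rw [h.integral_T_eq hLx hLy hs hr.1 (lt_of_le_of_lt (EReal.coe_le_coe_iff.2 hr.2) ht)] at b3
  have b4 := sq_integral_cell_le hLx hLy
    (h.contDiffOn_T_one (hsub (Set.left_mem_Icc.2 hst))).continuousOn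
  rw [← inv_mul_le_iff₀ hK] at b3
  linarith

theorem exists_integral_sq_T_le (Pr R : ℝ) (hLx : 0 < Lx) (hLy : 0 < Ly) (η : ℝ≥0∞) :
    ∃ A, 0 ≤ A ∧ ∀ {tmax : EReal} {u : ℝ → Pt → Vel} {p T : ℝ → Pt → ℝ},
      IsSolution Pr R Lx Ly η tmax u p T → ∀ {s t : ℝ}, 0 < s → s ≤ t → (t : EReal) < tmax →
      ∫ x in cell Lx Ly, T t x ^ 2 ≤ A * (1 + ∫ x in cell Lx Ly, T s x ^ 2) := by
  by_cases hη : η = ⊤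
  · subst hη
    exact exists_integral_sq_T_le_of_top hLx hLy
  · refine ⟨2 * ((1 + η.toReal) ^ 2 + 1) * (Lx * Ly) + 2, by positivity,
      fun {tmax u p T} h {s t} hs hst ht => ?_⟩
    have h1 := h.integral_sq_T_le_of_ne_top hLx hLy hη hs hst ht
    have h2 : 0 ≤ ∫ x in cell Lx Ly, T s x ^ 2 := integral_nonneg fun x => sq_nonneg _
    have h3 : 0 ≤ 2 * ((1 + η.toReal) ^ 2 + 1) * (Lx * Ly) := by positivity
    nlinarith [mul_nonneg h3 h2]

/-! ### The velocity -/

theorem continuousOn_ut (h : IsSolution Pr R Lx Ly η tmax u p T) {t : ℝ} (ht : t ∈ times tmax) :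
    ContinuousOn (fun x => deriv (fun s => u s x) t) slab :=
  continuousOn_slice (H := fun t x => deriv (fun s => u s x) t) h.ut_continuous ht

theorem hasDerivAt_u (h : IsSolution Pr R Lx Ly η tmax u p T) {t : ℝ} (ht : t ∈ times tmax)
    {x : Pt} (hx : x ∈ slab) (i : Fin 3) :
    HasDerivAt (fun s => u s x i) (deriv (fun s => u s x) t i) t :=
  ((EuclideanSpace.proj i : Vel →L[ℝ] ℝ).hasFDerivAt).comp_hasDerivAt t
    (h.u_differentiable t ht x hx).hasDerivAt

/-- The balance of the kinetic energy. -/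
theorem integral_momentum_le (h : IsSolution Pr R Lx Ly η tmax u p T) (hLx : 0 < Lx)
    (hLy : 0 < Ly) {t : ℝ} (ht : t ∈ times tmax) :
    Pr⁻¹ * ∫ x in cell Lx Ly, ∑ i, u t x i * deriv (fun s => u s x) t i ≤
      R * (∫ x in cell Lx Ly, u t x 2 * T t x) -
        ∫ x in cell Lx Ly, ∑ i, ∑ j, pd j (fun y => u t y i) x ^ 2 := by
  have hu := h.contDiffOn_u_one ht
  have hdu : ∀ i j, ContDiffOn ℝ 1 (pd j (fun y => u t y i)) slab := fun i j =>
    contDiffOn_pd (h.contDiffOn_u ht i) j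
  have hp := h.p_contDiff t ht
  have hE : ContDiffOn ℝ 1 (fun x => ∑ i, u t x i * u t x i) slab :=
    ContDiffOn.sum fun i _ => (hu i).mul (hu i)
  have hB : ContDiffOn ℝ 1 (fun x => Pr⁻¹ / 2 * (∑ i, u t x i * u t x i) + p t x) slab :=
    (contDiffOn_const.mul hE).add hp
  have hS : ∀ j, ContDiffOn ℝ 1 (fun x => ∑ i, u t x i * pd j (fun y => u t y i) x) slab :=
    fun j => ContDiffOn.sum fun i _ => (hu i).mul (hdu i j)
  have pu : ∀ i, HorizPeriodic Lx Ly (fun x => u t x i) := fun i =>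
    (h.u_periodic t ht).comp fun v => v i
  have hdiv := integral_div_nonpos hLx hLy
    (V := fun j x => (∑ i, u t x i * pd j (fun y => u t y i) x) -
      (Pr⁻¹ / 2 * (∑ i, u t x i * u t x i) + p t x) * u t x j)
    (fun j => (hS j).sub (hB.mul (hu j)))
    (fun j => (HorizPeriodic.sum _ fun i => (pu i).comp₂ ((pu i).pd j) fun a b => a * b).comp₂
      ((((h.u_periodic t ht).comp fun v => Pr⁻¹ / 2 * (∑ i, v i * v i)).comp₂
        (h.p_periodic t ht) fun a b => a + b).comp₂ (pu j) fun a b => a * b) fun a b => a - b)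
    (fun x hx => by simp [h.no_slip t ht x (.inl hx)])
    (fun x hx => by simp [h.no_slip t ht x (.inr hx)])
  rw [setIntegral_cell_congr (g := fun x => (∑ i, ∑ j, pd j (fun y => u t y i) x ^ 2) +
    (Pr⁻¹ * (∑ i, u t x i * deriv (fun s => u s x) t i) - R * (u t x 2 * T t x))) Lx Ly] at hdiv
  · have cut : ∀ i : Fin 3, ContinuousOn (fun x => deriv (fun s => u s x) t i) slab := fun i =>
      (EuclideanSpace.proj i : Vel →L[ℝ] ℝ).continuous.comp_continuousOn (h.continuousOn_ut ht)
    have i1 : IntegrableOn (fun x => ∑ i, ∑ j, pd j (fun y => u t y i) x ^ 2) (cell Lx Ly) :=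
      integrableOn_cell (continuousOn_finsetSum _ fun i _ => continuousOn_finsetSum _ fun j _ =>
        (hdu i j).continuousOn.pow 2) Lx Ly
    have i2 : IntegrableOn (fun x => Pr⁻¹ * (∑ i, u t x i * deriv (fun s => u s x) t i))
        (cell Lx Ly) :=
      integrableOn_cell (continuousOn_const.mul (continuousOn_finsetSum _ fun i _ =>
        (hu i).continuousOn.mul (cut i))) Lx Ly
    have i3 : IntegrableOn (fun x => R * (u t x 2 * T t x)) (cell Lx Ly) :=
      integrableOn_cell (continuousOn_const.mul ((hu 2).continuousOn.mul
        (h.contDiffOn_T_one ht).continuousOn)) Lx Ly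
    have i4 : IntegrableOn (fun x => Pr⁻¹ * (∑ i, u t x i * deriv (fun s => u s x) t i) -
        R * (u t x 2 * T t x)) (cell Lx Ly) := i2.sub i3
    rw [integral_add i1 i4, integral_sub i2 i3, integral_const_mul, integral_const_mul] at hdiv
    linarith
  · intro x h0 h1
    have hx : x ∈ slab := ⟨h0.le, h1.le⟩
    have hmom := h.momentum t ht x h0 h1
    have hinc := h.incompressible t ht x h0 h1
    have e : ∀ j, pd j (fun x => (∑ i, u t x i * pd j (fun y => u t y i) x) -
        (Pr⁻¹ / 2 * (∑ i, u t x i * u t x i) + p t x) * u t x j) x =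
        (∑ i, (u t x i * pd j (pd j (fun y => u t y i)) x +
          pd j (fun y => u t y i) x * pd j (fun y => u t y i) x)) -
        ((Pr⁻¹ / 2 * (∑ i, u t x i * u t x i) + p t x) * pd j (fun y => u t y j) x +
          u t x j * (Pr⁻¹ / 2 * (∑ i, (u t x i * pd j (fun y => u t y i) x +
            u t x i * pd j (fun y => u t y i) x)) + pd j (p t) x)) := by
      intro j
      rw [pd_sub (hS j) (hB.mul (hu j)) hx, pd_sum _ (fun i => (hu i).mul (hdu i j)) hx,
        pd_mul hB (hu j) hx, pd_add (contDiffOn_const.mul hE) hp hx,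
        pd_mul contDiffOn_const hE hx, pd_const _ hx,
        pd_sum _ (fun i => (hu i).mul (hu i)) hx]
      simp only [pd_mul (hu _) (hdu _ j) hx, pd_mul (hu _) (hu _) hx, mul_zero, add_zero]
    simp only [(h.hasDerivAt_u ht hx _).deriv] at hmom
    have m0 := hmom 0
    have m1 := hmom 1
    have m2 := hmom 2
    simp only [e]
    simp only [lap] at m0 m1 m2
    simp only [Fin.sum_univ_three, Fin.isValue, Fin.reduceEq, if_false, if_true]
      at m0 m1 m2 hinc ⊢
    linear_combination -u t x 0 * m0 - u t x 1 * m1 - u t x 2 * m2 -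
      (Pr⁻¹ / 2 * (u t x 0 * u t x 0 + u t x 1 * u t x 1 + u t x 2 * u t x 2) + p t x) * hinc

theorem integral_sq_u_le (h : IsSolution Pr R Lx Ly η tmax u p T) (hPr : 0 < Pr) (hLx : 0 < Lx)
    (hLy : 0 < Ly) {s t M : ℝ} (hs : 0 < s) (hst : s ≤ t) (ht : (t : EReal) < tmax)
    (hM : ∀ r ∈ Set.Icc s t, ∫ x in cell Lx Ly, T r x ^ 2 ≤ M) :
    ∫ x in cell Lx Ly, ∑ i, u t x i ^ 2 ≤
      (∫ x in cell Lx Ly, ∑ i, u s x i ^ 2) + 16 * R ^ 2 * M := by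
  have hsub := Icc_subset_times hs ht
  have hM0 : 0 ≤ M := (integral_nonneg fun x => sq_nonneg _).trans
    (hM s (Set.left_mem_Icc.2 hst))
  have cproj : ∀ i : Fin 3, Continuous fun v : Vel => v i := fun i =>
    (EuclideanSpace.proj i : Vel →L[ℝ] ℝ).continuous
  have key := le_add_div_of_hasDerivAt_le (y := fun r => ∫ x in cell Lx Ly, ∑ i, u r x i ^ 2)
    (y' := fun r => ∫ x in cell Lx Ly, ∑ i, 2 * (u r x i * deriv (fun s => u s x) r i))
    (κ := Pr / 4) (B := 4 * Pr * R ^ 2 * M) (by positivity) (by positivity) hst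
    (fun r hr => ?_) (fun r hr => ?_)
    (integral_nonneg fun x => Finset.sum_nonneg fun i _ => sq_nonneg _)
  · have e : 4 * Pr * R ^ 2 * M / (Pr / 4) = 16 * R ^ 2 * M := by field_simp; ring
    rwa [e] at key
  · refine hasDerivAt_integral_cell (isOpen_times tmax) (G := fun r x => ∑ i, u r x i ^ 2)
      (G' := fun r x => ∑ i, 2 * (u r x i * deriv (fun s => u s x) r i))
      (continuousOn_finsetSum _ fun i _ => ((cproj i).comp_continuousOn h.u_continuous).pow 2)
      (continuousOn_finsetSum _ fun i _ => continuousOn_const.mul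
        (((cproj i).comp_continuousOn h.u_continuous).mul
          ((cproj i).comp_continuousOn h.ut_continuous)))
      (fun q hq x hx => HasDerivAt.fun_sum fun i _ => ?_) Lx Ly (hsub hr)
    exact ((h.hasDerivAt_u hq hx i).fun_pow 2).congr_deriv (by push_cast; ring)
  · have hr' := hsub hr
    have hu := h.contDiffOn_u_one hr'
    have cT := (h.contDiffOn_T_one hr').continuousOn
    have b1 := h.integral_momentum_le hLx hLy hr'
    have iu : ∀ i, IntegrableOn (fun x => u r x i ^ 2) (cell Lx Ly) := fun i =>
      integrableOn_cell ((hu i).continuousOn.pow 2) Lx Ly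
    have ip : ∀ i j, IntegrableOn (fun x => pd j (fun y => u r y i) x ^ 2) (cell Lx Ly) :=
      fun i j => integrableOn_cell ((continuousOn_pd (hu i) j).pow 2) Lx Ly
    have b2 : ∫ x in cell Lx Ly, ∑ i, u r x i ^ 2 ≤
        4 * ∫ x in cell Lx Ly, ∑ i, ∑ j, pd j (fun y => u r y i) x ^ 2 := by
      rw [integral_finsetSum _ fun i _ => iu i, integral_finsetSum _ fun i _ =>
        integrable_finsetSum _ fun j _ => ip i j, Finset.mul_sum]
      refine Finset.sum_le_sum fun i _ => ?_
      refine (integral_sq_le_of_eq_zero_bottom hLx hLy (hu i)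
        ((h.u_periodic r hr').comp fun v => v i)
        (fun x hx => by rw [h.no_slip r hr' x (.inl hx)]; rfl)).trans ?_
      refine mul_le_mul_of_nonneg_left ?_ (by norm_num)
      refine integral_mono (ip i 2) (integrable_finsetSum _ fun j _ => ip i j) fun x => ?_
      exact Finset.single_le_sum (f := fun j => pd j (fun y => u r y i) x ^ 2)
        (fun j _ => sq_nonneg _) (Finset.mem_univ 2)
    have iT : IntegrableOn (fun x => T r x ^ 2) (cell Lx Ly) := integrableOn_cell (cT.pow 2) Lx Ly
    have iE : IntegrableOn (fun x => ∑ i, u r x i ^ 2) (cell Lx Ly) :=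
      integrable_finsetSum _ fun i _ => iu i
    have b3 : ∫ x in cell Lx Ly, R * (u r x 2 * T r x) ≤
        ∫ x in cell Lx Ly, (1 / 8 * (∑ i, u r x i ^ 2) + 2 * R ^ 2 * T r x ^ 2) := by
      refine integral_mono (integrableOn_cell (continuousOn_const.mul
        ((hu 2).continuousOn.mul cT)) Lx Ly) ((iE.const_mul _).add (iT.const_mul _)) fun x => ?_
      simp only [Fin.sum_univ_three]
      nlinarith [sq_nonneg (u r x 2 - 4 * (R * T r x)), sq_nonneg (u r x 0), sq_nonneg (u r x 1)]
    rw [integral_const_mul, integral_add (iE.const_mul _) (iT.const_mul _), integral_const_mul,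
      integral_const_mul] at b3
    have b4 : 2 * R ^ 2 * ∫ x in cell Lx Ly, T r x ^ 2 ≤ 2 * R ^ 2 * M :=
      mul_le_mul_of_nonneg_left (hM r hr) (by positivity)
    have b5 : Pr⁻¹ * ∫ x in cell Lx Ly, ∑ i, u r x i * deriv (fun s => u s x) r i ≤
        -(1 / 8) * (∫ x in cell Lx Ly, ∑ i, u r x i ^ 2) + 2 * R ^ 2 * M := by linarith
    rw [inv_mul_le_iff₀ hPr] at b5
    simp_rw [← Finset.mul_sum]
    rw [integral_const_mul]
    linarith

end IsSolution

end Solution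

/-! ### The bound in `L²` -/

theorem normL2_eq {F : Type} [NormedAddCommGroup F] {f : Pt → F} (hf : ContinuousOn f slab)
    (Lx Ly : ℝ) :
    normL2 Lx Ly f = ENNReal.ofReal (√(∫ x in cell Lx Ly, ‖f x‖ ^ 2)) := by
  have hm : AEStronglyMeasurable f (volume.restrict (cell Lx Ly)) :=
    (hf.mono (cell_subset_slab Lx Ly)).aestronglyMeasurable_of_isCompact (isCompact_cell Lx Ly)
      (measurableSet_cell Lx Ly)
  have hL : MemLp f 2 (volume.restrict (cell Lx Ly)) :=
    (memLp_two_iff_integrable_sq_norm hm).2 (integrableOn_cell (hf.norm.pow 2) Lx Ly)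
  rw [normL2, hL.eLpNorm_eq_integral_rpow_norm two_ne_zero ENNReal.ofNat_ne_top, Real.sqrt_eq_rpow]
  simp

theorem sqrt_add_le {a b : ℝ} (ha : 0 ≤ a) (hb : 0 ≤ b) : √(a + b) ≤ √a + √b := by
  refine Real.sqrt_le_iff.2 ⟨by positivity, ?_⟩
  nlinarith [Real.sq_sqrt ha, Real.sq_sqrt hb, mul_nonneg (Real.sqrt_nonneg a) (Real.sqrt_nonneg b)]

theorem IsSolution.exists_normL2_le {Pr R Lx Ly : ℝ} (hPr : 0 < Pr) (hLx : 0 < Lx) (hLy : 0 < Ly)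
    (η : ℝ≥0∞) :
    ∃ C : ℝ≥0, 1 ≤ C ∧ ∀ {tmax : EReal} {u : ℝ → Pt → Vel} {p T : ℝ → Pt → ℝ},
      IsSolution Pr R Lx Ly η tmax u p T → ∀ {s t : ℝ}, 0 < s → s ≤ t → (t : EReal) < tmax →
      normL2 Lx Ly (u t) + normL2 Lx Ly (T t) ≤
        C * (1 + normL2 Lx Ly (u s) + normL2 Lx Ly (T s)) := by
  obtain ⟨A, hA, hT⟩ := exists_integral_sq_T_le Pr R hLx hLy η
  refine ⟨(1 + √A + √(16 * R ^ 2 * A)).toNNReal, ?_, fun {tmax u p T} h {s t} hs hst ht => ?_⟩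
  · rw [Real.one_le_toNNReal]
    linarith [Real.sqrt_nonneg A, Real.sqrt_nonneg (16 * R ^ 2 * A)]
  have hsub := Icc_subset_times hs ht
  have hsm := hsub (Set.left_mem_Icc.2 hst)
  have htm := hsub (Set.right_mem_Icc.2 hst)
  set τ := ∫ x in cell Lx Ly, T s x ^ 2 with hτ
  have hτ0 : 0 ≤ τ := integral_nonneg fun x => sq_nonneg _
  have h1 := hT h hs hst ht
  have h2 := h.integral_sq_u_le hPr hLx hLy (M := A * (1 + τ)) hs hst ht fun r hr =>
    hT h hs hr.1 (lt_of_le_of_lt (EReal.coe_le_coe_iff.2 hr.2) ht)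
  have eu : ∀ r ∈ times tmax, normL2 Lx Ly (u r) =
      ENNReal.ofReal (√(∫ x in cell Lx Ly, ∑ i, u r x i ^ 2)) := by
    intro r hr
    rw [normL2_eq (h.u_contDiff r hr).continuousOn]
    simp_rw [EuclideanSpace.real_norm_sq_eq]
  have eT : ∀ r ∈ times tmax, normL2 Lx Ly (T r) =
      ENNReal.ofReal (√(∫ x in cell Lx Ly, T r x ^ 2)) := by
    intro r hr
    rw [normL2_eq (h.T_contDiff r hr).continuousOn]
    simp_rw [Real.norm_eq_abs, sq_abs]
  have hroot : √(1 + τ) ≤ 1 + √τ := by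
    simpa using sqrt_add_le zero_le_one hτ0
  set y := ∫ x in cell Lx Ly, ∑ i, u s x i ^ 2 with hy
  have hy0 : 0 ≤ y := integral_nonneg fun x => Finset.sum_nonneg fun i _ => sq_nonneg _
  have h3 : √(∫ x in cell Lx Ly, T t x ^ 2) ≤ √A * (1 + √τ) := by
    refine (Real.sqrt_le_sqrt h1).trans ?_
    rw [Real.sqrt_mul hA]
    exact mul_le_mul_of_nonneg_left hroot (Real.sqrt_nonneg _)
  have h4 : √(∫ x in cell Lx Ly, ∑ i, u t x i ^ 2) ≤ √y + √(16 * R ^ 2 * A) * (1 + √τ) := by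
    refine (Real.sqrt_le_sqrt h2).trans ?_
    refine (sqrt_add_le hy0 (by positivity)).trans ?_
    rw [← mul_assoc, Real.sqrt_mul (by positivity)]
    exact add_le_add_right (mul_le_mul_of_nonneg_left hroot (Real.sqrt_nonneg _)) _
  rw [eu t htm, eT t htm, eu s hsm, eT s hsm, ← hτ, ← hy, ← ENNReal.ofReal_add (by positivity)
    (by positivity), ← ENNReal.ofReal_one, ← ENNReal.ofReal_add (by positivity) (by positivity),
    ← ENNReal.ofReal_add (by positivity) (by positivity)]
  change _ ≤ ENNReal.ofReal _ * _
  rw [← ENNReal.ofReal_mul (by positivity)]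
  refine ENNReal.ofReal_le_ofReal ?_
  have n1 := Real.sqrt_nonneg A
  have n2 := Real.sqrt_nonneg (16 * R ^ 2 * A)
  have n3 := Real.sqrt_nonneg y
  have n4 := Real.sqrt_nonneg τ
  nlinarith [mul_nonneg n1 n3, mul_nonneg n2 n3]

theorem normL2_le_sub_add {F : Type} [NormedAddCommGroup F] {f g : Pt → F} {Lx Ly : ℝ}
    (hf : ContinuousOn f slab) (hg : MemLp g 2 (volume.restrict (cell Lx Ly))) :
    normL2 Lx Ly f ≤ normL2 Lx Ly (fun x => f x - g x) + normL2 Lx Ly g := by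
  have hm : AEStronglyMeasurable f (volume.restrict (cell Lx Ly)) :=
    (hf.mono (cell_subset_slab Lx Ly)).aestronglyMeasurable_of_isCompact (isCompact_cell Lx Ly)
      (measurableSet_cell Lx Ly)
  have := eLpNorm_add_le (hm.sub hg.1) hg.1 (p := 2) one_le_two
  rwa [sub_add_cancel] at this

end RayleighBenard

open RayleighBenard in
theorem mainTheorem2 (Pr R Lx Ly : ℝ) (hPr : 0 < Pr) (hR : 0 < R) (hLx : 0 < Lx) (hLy : 0 < Ly)
    (η : ℝ≥0∞) :
    ∃ C : ℝ≥0, ∀ (tmax : EReal) (u : ℝ → RayleighBenard.Pt → RayleighBenard.Vel)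
      (p T : ℝ → RayleighBenard.Pt → ℝ), 0 < tmax →
      RayleighBenard.IsSolution Pr R Lx Ly η tmax u p T →
      ∀ t : ℝ, 0 ≤ t → (t : EReal) < tmax →
        RayleighBenard.normL2 Lx Ly (u t) + RayleighBenard.normL2 Lx Ly (T t)
          ≤ C * (1 + RayleighBenard.normL2 Lx Ly (u 0) + RayleighBenard.normL2 Lx Ly (T 0)) := by
  obtain ⟨C, hC1, hC⟩ := IsSolution.exists_normL2_le (R := R) hPr hLx hLy η
  refine ⟨C, fun tmax u p T _ h t ht0 ht => ?_⟩
  rcases ht0.eq_or_lt with rfl | ht0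
  · have hC1' : (1 : ℝ≥0∞) ≤ C := by exact_mod_cast hC1
    refine le_trans ?_ (le_mul_of_one_le_left' hC1')
    rw [add_assoc]
    exact le_add_self
  have hlim : Tendsto (fun s => (C : ℝ≥0∞) *
      (1 + (normL2 Lx Ly (fun x => u s x - u 0 x) + normL2 Lx Ly (u 0)) +
        (normL2 Lx Ly (fun x => T s x - T 0 x) + normL2 Lx Ly (T 0)))) (𝓝[>] 0)
      (𝓝 (C * (1 + (0 + normL2 Lx Ly (u 0)) + (0 + normL2 Lx Ly (T 0))))) :=
    ENNReal.Tendsto.const_mul ((tendsto_const_nhds.add (h.u_initial.add tendsto_const_nhds)).add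
      (h.T_initial.add tendsto_const_nhds)) (.inr ENNReal.coe_ne_top)
  simp only [zero_add] at hlim
  refine ge_of_tendsto hlim ?_
  filter_upwards [Ioc_mem_nhdsGT ht0] with s hs
  have hsm := Icc_subset_times hs.1 ht (Set.left_mem_Icc.2 hs.2)
  refine (hC h hs.1 hs.2 ht).trans ?_
  gcongr
  · exact normL2_le_sub_add (h.u_contDiff s hsm).continuousOn h.u_zero_memLp
  · exact normL2_le_sub_add (h.T_contDiff s hsm).continuousOn h.T_zero_memLp
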